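/- For a rooted ordered tree $T$ let $|T|$ be its number of vertices, $Z(T)$ its Hosoya index (the number of sets of edges, including the empty set, in which no two distinct edges share an endpoint), and $\rho(T)$ the number of its subtrees (subgraphs that are non-empty trees). Let $$\mathrm{ZR}(z)=\sum_T Z(T)\rho(T)z^{|T|},$$ where $T$ runs over all rooted ordered trees, and $z_0=\frac{7+3\sqrt5}{128}$. Then $z_0$ is the dominant singularity of $\mathrm{ZR}$ and is of square-root type: the power series has radius of convergence $z_0$; $\mathrm{ZR}$ continues analytically to a neighbourhood of every point $\zeta\ne z_0$ with $|\zeta|=z_0$; and for $|z|<z_0$ near $z_0$ one has $\mathrm{ZR}(z)=h\bigl(\sqrt{1-z/z_0}\bigr)$ (principal square root) with $h$ analytic at $0$ and $$h(0)=\frac{211+93\sqrt5}{928},\qquad h'(0)=-\frac1{232}\sqrt{\frac{5(128985+57683\sqrt5)}{58}}\neq0 .$$ Moreover, if $T_n$ is chosen uniformly at random among all rooted ordered trees on $n$ vertices, and $Z_n=Z(T_n)$, $\rho_n=\rho(T_n)$, then, as $n\to\infty$, $$E(Z_n\rho_n)\sim\frac1{116}\sqrt{\frac{5(128985+57683\sqrt5)}{58}}\,\bigl(8(7-3\sqrt5)\bigr)^n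 .$$ -/

import Mathlib

open Filter Topology

/-- Rooted ordered (plane) trees: a root together with the ordered list of its branches. -/
inductive OrderedTree : Type where
  | node (branches : List OrderedTree) : OrderedTree

namespace OrderedTree

/-- The vertices of a rooted ordered tree: the root, and the vertices of its branches. -/
inductive Vertex : OrderedTree → Type where
  | root {ts : List OrderedTree} : Vertex (node ts)
  | inBranch {ts : List OrderedTree} (i : Fin ts.length) (v : Vertex (ts.get i)) : Vertex (node ts)

/-- The root vertex of a rooted ordered tree. -/
def rootVertex : (T : OrderedTree) → Vertex T
  | node _ => Vertex.root

/-- `IsChild u v` means that `v` is a child of `u`. -/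
inductive IsChild : {T : OrderedTree} → Vertex T → Vertex T → Prop where
  | ofRoot {ts : List OrderedTree} (i : Fin ts.length) :
      IsChild (Vertex.root (ts := ts)) (Vertex.inBranch i (rootVertex (ts.get i)))
  | inBranch {ts : List OrderedTree} (i : Fin ts.length) {u v : Vertex (ts.get i)} :
      IsChild u v → IsChild (Vertex.inBranch i u) (Vertex.inBranch i v)

/-- The underlying graph of a rooted ordered tree: edges join vertices to their children. -/
def graph (T : OrderedTree) : SimpleGraph T.Vertex :=
  SimpleGraph.fromRel IsChild

/-- The number `|T|` of vertices of `T`. -/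
noncomputable def order (T : OrderedTree) : ℕ := Nat.card T.Vertex

/-- Splitting off the first branch of a tree. -/
def vertexConsEquiv (t : OrderedTree) (ts : List OrderedTree) :
    Vertex (node (t :: ts)) ≃ Vertex t ⊕ Vertex (node ts) where
  toFun
    | .root => .inr .root
    | .inBranch ⟨0, _⟩ v => .inl v
    | .inBranch ⟨i + 1, hi⟩ v => .inr (.inBranch ⟨i, Nat.lt_of_succ_lt_succ hi⟩ v)
  invFun
    | .inl v => .inBranch (ts := t :: ts) ⟨0, Nat.succ_pos _⟩ v
    | .inr .root => .root
    | .inr (.inBranch ⟨i, hi⟩ v) => .inBranch (ts := t :: ts) ⟨i + 1, Nat.succ_lt_succ hi⟩ v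
  left_inv := by
    rintro (_ | ⟨⟨_ | i, hi⟩, v⟩) <;> rfl
  right_inv := by
    rintro (v | (_ | ⟨⟨i, hi⟩, v⟩)) <;> rfl

instance instUniqueVertexNil : Unique (Vertex (node [])) where
  default := .root
  uniq
    | .root => rfl
    | .inBranch i _ => i.elim0

theorem finite_vertex : (T : OrderedTree) → Finite (Vertex T)
  | node [] => inferInstance
  | node (t :: ts) =>
    have := finite_vertex t
    have := finite_vertex (node ts)
    Finite.of_equiv _ (vertexConsEquiv t ts).symm

instance instFiniteVertex (T : OrderedTree) : Finite (Vertex T) := finite_vertex T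

instance instNonemptyVertex (T : OrderedTree) : Nonempty (Vertex T) := ⟨rootVertex T⟩

theorem order_pos (T : OrderedTree) : 0 < T.order := Nat.card_pos

theorem order_node_nil : (node []).order = 1 := Nat.card_unique

theorem order_node_cons (t : OrderedTree) (ts : List OrderedTree) :
    (node (t :: ts)).order = t.order + (node ts).order := by
  unfold order
  rw [Nat.card_congr (vertexConsEquiv t ts), Nat.card_sum]

theorem finite_order_le (n : ℕ) : {T : OrderedTree | T.order ≤ n}.Finite := by
  induction n with
  | zero =>
    refine Set.Finite.subset Set.finite_empty fun T hT => ?_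
    have h1 : T.order ≤ 0 := hT
    have h2 := T.order_pos
    omega
  | succ n ih =>
    refine ((Set.finite_singleton (node [])).union
      (Set.Finite.image2 (fun t T => match T with | node ts => node (t :: ts)) ih ih)).subset ?_
    rintro ⟨_ | ⟨t, ts⟩⟩ hT
    · exact Or.inl rfl
    · have h1 : (node (t :: ts)).order ≤ n + 1 := hT
      rw [order_node_cons] at h1
      have h2 := t.order_pos
      have h3 := (node ts).order_pos
      refine Or.inr ⟨t, ?_, node ts, ?_, rfl⟩
      · change t.order ≤ n
        omega
      · change (node ts).order ≤ n
        omega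

theorem finite_order_eq (n : ℕ) : {T : OrderedTree | T.order = n}.Finite :=
  (finite_order_le n).subset fun _ h => le_of_eq h

/-- The finite set of all rooted ordered trees on `n` vertices. -/
noncomputable def treesOfOrder (n : ℕ) : Finset OrderedTree := (finite_order_eq n).toFinset

/-- The expected value of a parameter `X` of a uniformly random rooted ordered tree
on `n` vertices. -/
noncomputable def expectation (X : OrderedTree → ℝ) (n : ℕ) : ℝ :=
  (∑ T ∈ treesOfOrder n, X T) / ((treesOfOrder n).card : ℝ)

end OrderedTree

/-- The Hosoya index (`Z`-index) of a graph: the number of edge subsets (including the empty one)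
in which no two distinct edges have a common endpoint. -/
noncomputable def hosoyaIndex {V : Type*} (G : SimpleGraph V) : ℕ :=
  Nat.card {M : Set (Sym2 V) // M ⊆ G.edgeSet ∧ M.Pairwise fun e f => ∀ v, v ∈ e → v ∉ f}

/-- The `ρ`-index of a graph: the number of its subgraphs that are (nonempty) trees. -/
noncomputable def subtreeIndex {V : Type*} (G : SimpleGraph V) : ℕ :=
  Nat.card {H : G.Subgraph // H.coe.IsTree}

namespace OrderedTree

/-- The product `Z(T) ρ(T)`. -/
noncomputable def hosoyaMulSubtree (T : OrderedTree) : ℕ :=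
  hosoyaIndex T.graph * subtreeIndex T.graph

/-- The coefficient of `z ^ n` in the generating function `ZR(z) = ∑_T Z(T) ρ(T) z ^ |T|`. -/
noncomputable def coeffZR (n : ℕ) : ℂ := ∑ T ∈ treesOfOrder n, (T.hosoyaMulSubtree : ℂ)

end OrderedTree

/-- The power series `A(z) = ∑ a n * z ^ n` has `z₀ > 0` as its dominant singularity, and this is a
square-root singularity with expansion `c₀ - c₁ * √(1 - z / z₀) + ⋯`: the radius of convergence
is `z₀`, the function continues analytically to a neighbourhood of every other point of the circle
of convergence, and near `z₀` it is an analytic function `h` of `√(1 - z / z₀)` with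
`h 0 = c₀` and `h' 0 = -c₁ ≠ 0`. -/
structure HasDominantSqrtSingularity (a : ℕ → ℂ) (z₀ c₀ c₁ : ℝ) : Prop where
  pos : 0 < z₀
  coeff_ne_zero : c₁ ≠ 0
  radius_eq : (FormalMultilinearSeries.ofScalars ℂ a).radius = ENNReal.ofReal z₀
  regular : ∀ ζ : ℂ, ‖ζ‖ = z₀ → ζ ≠ (z₀ : ℂ) →
    ∃ g : ℂ → ℂ, AnalyticAt ℂ g ζ ∧
      ∀ᶠ z in 𝓝 ζ, ‖z‖ < z₀ → HasSum (fun n => a n * z ^ n) (g z)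
  expansion : ∃ h : ℂ → ℂ, AnalyticAt ℂ h 0 ∧ h 0 = (c₀ : ℂ) ∧ deriv h 0 = -(c₁ : ℂ) ∧
    ∀ᶠ z in 𝓝 (z₀ : ℂ), ‖z‖ < z₀ →
      HasSum (fun n => a n * z ^ n) (h ((1 - z / (z₀ : ℂ)) ^ (1 / 2 : ℂ)))

/-!
The theorem rests on a polynomial system for generating functions, which is uniformized by a curve
on which the dominant singularity is visible as a simple critical point.

*Recursions.* Adding a first branch `t` to an ordered tree `S` joins `t` and `S` by an edge between
their roots. Matchings either omit this edge or use it and leave both roots uncovered; subtrees lie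
on one side or consist of two subtrees through the roots. Hence the numbers `Z`, `Z₀`, `ρ`, `r` of
matchings, matchings avoiding the root, subtrees and subtrees through the root obey
`Z = Z Z + Z₀ Z₀`, `Z₀ = Z Z₀`, `ρ = ρ + ρ + r r`, `r = (1 + r) r`, where in each product the first
factor belongs to `t` and the second to `S`. The products of these numbers give six generating
functions `C, D, A, B, E, F` of the weights `Z, Z₀, Z r, Z₀ r, Z ρ, Z₀ ρ`, related by six polynomial
equations (`gf_system`); `E` is the series `ZR`. The system has an explicit nonnegative solution at
`z₀`, which bounds all partial sums by induction (`boundedAt_critZ_all`), so that all six series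
converge absolutely for `|z| ≤ z₀`.

*The curve.* After division by `u = 1 - C` the equations are homogeneous in `u`, and with `t = D / u`
and `α = A / u` they become (`param_equations`)
`z (1 + t + t²)² = t`, `(α - t - α²) (1 - α)² = t² (1 - α) + t²`, `E = ` a rational function of
`t, α`. For `|z| = z₀`, `z ≠ z₀`, the bounds `|t| < t₀` and `|α| ≤ α₀` prevent the partial
derivatives of the two relations with respect to `t` and `α` from vanishing, and the implicit
function theorem continues `E` analytically beyond such points (`regular_coeffZR`). At the critical point
`(t₀, α₀)`, on the other hand, `t` is an analytic function of `α` with a simple critical point, and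
`1 - z / z₀ = (α₀ - α)² κ` with `κ ≠ 0`. Taking roots and inverting gives `α`, and then `E`, as
an analytic function of `√(1 - z / z₀)` (`expansion_coeffZR`).

*Transfer.* The expansion at `z₀` up to the term `(1 - z / z₀) ^ (3/2)` is subtracted from the
series. The remainder has a bounded second derivative in the disc, so by Cauchy's estimate its
coefficients are `O(n⁻² z₀⁻ⁿ)`, which is negligible. The coefficients of `√(1 - z / z₀)` are Catalan
numbers up to elementary factors, and ordered trees are counted by the same Catalan numbers, so that
the expectation is obtained without recourse to their asymptotic formula
(`tendsto_coeff_div_catalan`). The radius of convergence follows from the quotients of consecutive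
coefficients.
-/

/-! ### Matchings and connected vertex sets of a graph -/

namespace SimpleGraph

variable {V V₁ V₂ : Type*}

/-- The edge set of a matching, encoded as a symmetric relation on the vertices: `R x y` says that
`s(x, y)` is one of the chosen edges. -/
structure IsMatchingRel (G : SimpleGraph V) (R : V → V → Prop) : Prop where
  symm : ∀ x y, R x y → R y x
  adj : ∀ x y, R x y → G.Adj x y
  unique : ∀ x y z, R x y → R x z → y = z

/-- The number of matchings of `G` that leave the vertex `a` uncovered. -/
noncomputable def hosoyaIndexAvoiding (G : SimpleGraph V) (a : V) : ℕ :=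
  Nat.card {R : V → V → Prop // G.IsMatchingRel R ∧ ∀ y, ¬ R a y}

theorem hosoyaIndex_eq_card_isMatchingRel (G : SimpleGraph V) :
    hosoyaIndex G = Nat.card {R : V → V → Prop // G.IsMatchingRel R} := by
  refine Nat.card_congr
    { toFun := fun M => ⟨fun x y => s(x, y) ∈ M.1, ?_⟩
      invFun := fun R => ⟨Sym2.fromRel (r := R.1) ⟨R.2.symm⟩, ?_⟩
      left_inv := ?_
      right_inv := ?_ }
  · refine ⟨fun x y h => by rwa [Sym2.eq_swap], fun x y h => M.2.1 h, fun x y z hy hz => ?_⟩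
    by_contra hne
    refine M.2.2 hy hz ?_ x (Sym2.mem_mk_left x y) (Sym2.mem_mk_left x z)
    rw [Ne, Sym2.congr_right]
    exact hne
  · refine ⟨?_, ?_⟩
    · intro e
      induction e with | h x y => exact fun h => R.2.adj x y h
    · intro e he f hf hne v hve hvf
      obtain ⟨x, rfl⟩ := hve
      obtain ⟨y, rfl⟩ := hvf
      exact hne (by rw [R.2.unique v x y he hf])
  · intro M
    ext e
    induction e with | h x y => rfl
  · intro R
    rfl

/-- Connectedness of a vertex set, expressed by the principle that a non-empty part of the set which
is closed under adjacency is the whole set. -/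
structure IsConnSet (G : SimpleGraph V) (S : Set V) : Prop where
  nonempty : S.Nonempty
  spread : ∀ p : V → Prop, (∀ x ∈ S, ∀ y ∈ S, G.Adj x y → p x → p y) →
    ∀ x ∈ S, p x → ∀ y ∈ S, p y

/-- The number of connected vertex sets of `G`. -/
noncomputable def connSetCount (G : SimpleGraph V) : ℕ :=
  Nat.card {S : Set V // G.IsConnSet S}

/-- The number of connected vertex sets of `G` that contain the vertex `a`. -/
noncomputable def connSetCountThrough (G : SimpleGraph V) (a : V) : ℕ :=
  Nat.card {S : Set V // G.IsConnSet S ∧ a ∈ S}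

/-- The ends of every edge of `G` are separated by a bipartition of the vertices that no other edge
crosses. This property of forests passes directly to graphs joined by an edge. -/
def EveryEdgeCuts (G : SimpleGraph V) : Prop :=
  ∀ u v, G.Adj u v → ∃ p : V → Prop, p u ∧ ¬ p v ∧
    ∀ x y, G.Adj x y → s(x, y) ≠ s(u, v) → p x → p y

theorem Reachable.of_closed {G : SimpleGraph V} (p : V → Prop)
    (hp : ∀ x y, G.Adj x y → p x → p y) {u v : V} (h : G.Reachable u v) (hu : p u) : p v := by
  obtain ⟨w⟩ := h
  induction w with
  | nil => exact hu
  | cons h _ ih => exact ih (hp _ _ h hu)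

theorem EveryEdgeCuts.isAcyclic {G : SimpleGraph V} (h : G.EveryEdgeCuts) : G.IsAcyclic := by
  rw [isAcyclic_iff_forall_adj_isBridge]
  intro u v huv
  rw [isBridge_iff]
  intro hr
  obtain ⟨p, hu, hv, hp⟩ := h u v huv
  refine hv (hr.of_closed p (fun x y hxy hx => ?_) hu)
  rw [deleteEdges_adj] at hxy
  exact hp x y hxy.1 (by simpa using hxy.2) hx

/-- The vertex set of a connected subgraph `H` is connected in `G`; the second part records the
principle of spreading along the edges of `H` itself. -/
theorem IsConnSet.of_connected {G : SimpleGraph V} {H : G.Subgraph} (h : H.coe.Connected) :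
    G.IsConnSet H.verts ∧ ∀ p : V → Prop, (∀ x y, H.Adj x y → p x → p y) →
    ∀ x ∈ H.verts, p x → ∀ y ∈ H.verts, p y := by
  have key : ∀ p : V → Prop, (∀ x y, H.Adj x y → p x → p y) →
      ∀ x ∈ H.verts, p x → ∀ y ∈ H.verts, p y := fun p hp x hx hpx y hy =>
    (h.preconnected ⟨x, hx⟩ ⟨y, hy⟩).of_closed (fun z => p z.1)
      (fun z w hzw => hp z.1 w.1 hzw) hpx
  refine ⟨⟨?_, fun p hp => key p fun x y hxy =>
    hp x (H.edge_vert hxy) y (H.edge_vert hxy.symm) hxy.adj_sub⟩, key⟩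
  obtain ⟨x⟩ := h.nonempty
  exact ⟨x.1, x.2⟩

theorem IsConnSet.connected {G : SimpleGraph V} {S : Set V} (h : G.IsConnSet S) :
    ((⊤ : G.Subgraph).induce S).coe.Connected := by
  obtain ⟨x, hx⟩ := h.nonempty
  have : Nonempty ((⊤ : G.Subgraph).induce S).verts := ⟨⟨x, hx⟩⟩
  refine ⟨fun u v => ?_⟩
  refine (h.spread (fun z => ∃ hz : z ∈ S,
    ((⊤ : G.Subgraph).induce S).coe.Reachable u ⟨z, hz⟩) ?_ u.1 u.2 ⟨u.2, ?_⟩ v.1 v.2).2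
  · rintro y hy z hz hyz ⟨_, hr⟩
    refine ⟨hz, hr.trans (Adj.reachable ?_)⟩
    simp only [Subgraph.coe_adj, Subgraph.induce_adj, Subgraph.top_adj]
    exact ⟨hy, hz, hyz⟩
  · exact Reachable.refl _

/-- In a forest the subtrees are the subgraphs induced by connected vertex sets. -/
theorem EveryEdgeCuts.subtreeIndex_eq {G : SimpleGraph V} (h : G.EveryEdgeCuts) :
    subtreeIndex G = G.connSetCount := by
  refine Nat.card_congr
    { toFun := fun H => ⟨H.1.verts, (IsConnSet.of_connected H.2.connected).1⟩
      invFun := fun S => ⟨(⊤ : G.Subgraph).induce S.1, S.2.connected, h.isAcyclic.subgraph _⟩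
      left_inv := ?_
      right_inv := fun S => rfl }
  intro H
  refine Subtype.ext (Subgraph.ext rfl ?_)
  ext u v
  simp only [Subgraph.induce_adj, Subgraph.top_adj]
  refine ⟨fun ⟨hu, hv, huv⟩ => ?_, fun huv =>
    ⟨H.1.edge_vert huv, H.1.edge_vert huv.symm, huv.adj_sub⟩⟩
  by_contra hH
  -- an edge of `G` missing from `H` would disconnect `H`
  obtain ⟨p, hpu, hpv, hp⟩ := h u v huv
  refine hpv ((IsConnSet.of_connected H.2.connected).2 p (fun x y hxy => ?_) u hu hpu v hv)
  refine hp x y hxy.adj_sub fun he => hH ?_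
  rcases Sym2.eq_iff.1 he with ⟨rfl, rfl⟩ | ⟨rfl, rfl⟩
  · exact hxy
  · exact hxy.symm

/-! ### Isomorphism invariance -/

theorem IsMatchingRel.comp_iso {G : SimpleGraph V} {G' : SimpleGraph V₁} (e : G ≃g G')
    {R : V₁ → V₁ → Prop} (h : G'.IsMatchingRel R) :
    G.IsMatchingRel fun x y => R (e x) (e y) :=
  ⟨fun _ _ => h.symm _ _, fun _ _ hxy => e.map_rel_iff.1 (h.adj _ _ hxy),
    fun _ _ _ hy hz => e.injective (h.unique _ _ _ hy hz)⟩

theorem IsConnSet.preimage_iso {G : SimpleGraph V} {G' : SimpleGraph V₁} (e : G ≃g G')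
    {S : Set V₁} (h : G'.IsConnSet S) : G.IsConnSet (e ⁻¹' S) := by
  obtain ⟨x, hx⟩ := h.nonempty
  refine ⟨⟨e.symm x, by simpa using hx⟩, fun p hp x hx hpx y hy => ?_⟩
  have := h.spread (fun z => p (e.symm z)) (fun z hz w hw hzw => hp _ (by simpa using hz) _
    (by simpa using hw) (e.symm.map_rel_iff.2 hzw)) (e x) hx (by simpa using hpx) (e y) hy
  simpa using this

/-- Transport of matchings along a graph isomorphism. -/
def matchingRelEquiv {G : SimpleGraph V} {G' : SimpleGraph V₁} (e : G ≃g G') :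
    {R : V → V → Prop // G.IsMatchingRel R} ≃ {R : V₁ → V₁ → Prop // G'.IsMatchingRel R} where
  toFun R := ⟨_, R.2.comp_iso e.symm⟩
  invFun R := ⟨_, R.2.comp_iso e⟩
  left_inv R := Subtype.ext (by funext x y; simp)
  right_inv R := Subtype.ext (by funext x y; simp)

/-- Transport of connected vertex sets along a graph isomorphism. -/
def connSetEquiv {G : SimpleGraph V} {G' : SimpleGraph V₁} (e : G ≃g G') :
    {S : Set V // G.IsConnSet S} ≃ {S : Set V₁ // G'.IsConnSet S} where
  toFun S := ⟨_, S.2.preimage_iso e.symm⟩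
  invFun S := ⟨_, S.2.preimage_iso e⟩
  left_inv S := Subtype.ext (by ext x; simp)
  right_inv S := Subtype.ext (by ext x; simp)

theorem hosoyaIndex_congr {G : SimpleGraph V} {G' : SimpleGraph V₁} (e : G ≃g G') :
    hosoyaIndex G = hosoyaIndex G' := by
  rw [hosoyaIndex_eq_card_isMatchingRel, hosoyaIndex_eq_card_isMatchingRel]
  exact Nat.card_congr (matchingRelEquiv e)

theorem hosoyaIndexAvoiding_congr {G : SimpleGraph V} {G' : SimpleGraph V₁} (e : G ≃g G') (a : V) :
    G.hosoyaIndexAvoiding a = G'.hosoyaIndexAvoiding (e a) := by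
  refine Nat.card_congr ((Equiv.subtypeSubtypeEquivSubtypeInter _ _).symm.trans
    (((matchingRelEquiv e).subtypeEquiv fun R => ?_).trans
      (Equiv.subtypeSubtypeEquivSubtypeInter _ _)))
  change (∀ y, ¬ R.1 a y) ↔ ∀ y, ¬ R.1 (e.symm (e a)) (e.symm y)
  rw [e.symm_apply_apply]
  exact ⟨fun h y => h _, fun h y => by simpa using h (e y)⟩

theorem connSetCount_congr {G : SimpleGraph V} {G' : SimpleGraph V₁} (e : G ≃g G') :
    G.connSetCount = G'.connSetCount :=
  Nat.card_congr (connSetEquiv e)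

theorem connSetCountThrough_congr {G : SimpleGraph V} {G' : SimpleGraph V₁} (e : G ≃g G') (a : V) :
    G.connSetCountThrough a = G'.connSetCountThrough (e a) := by
  refine Nat.card_congr ((Equiv.subtypeSubtypeEquivSubtypeInter _ _).symm.trans
    (((connSetEquiv e).subtypeEquiv fun S => ?_).trans
      (Equiv.subtypeSubtypeEquivSubtypeInter _ _)))
  change a ∈ S.1 ↔ e.symm (e a) ∈ S.1
  rw [e.symm_apply_apply]

theorem EveryEdgeCuts.congr {G : SimpleGraph V} {G' : SimpleGraph V₁} (e : G ≃g G')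
    (h : G'.EveryEdgeCuts) : G.EveryEdgeCuts := by
  intro u v huv
  obtain ⟨p, hu, hv, hp⟩ := h (e u) (e v) (e.map_rel_iff.2 huv)
  refine ⟨fun x => p (e x), hu, hv, fun x y hxy hne => hp _ _ (e.map_rel_iff.2 hxy) fun he => ?_⟩
  refine hne (Sym2.map.injective e.injective ?_)
  simpa using he

/-! ### Two rooted graphs joined by an edge between their roots -/

/-- The disjoint union of `G₁` and `G₂` together with an edge joining `a` to `b`. -/
def glue (G₁ : SimpleGraph V₁) (G₂ : SimpleGraph V₂) (a : V₁) (b : V₂) :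
    SimpleGraph (V₁ ⊕ V₂) where
  Adj
    | .inl x, .inl y => G₁.Adj x y
    | .inr x, .inr y => G₂.Adj x y
    | .inl x, .inr y => x = a ∧ y = b
    | .inr y, .inl x => x = a ∧ y = b
  symm := ⟨by
    rintro (x | x) (y | y) h
    exacts [G₁.adj_symm h, h, h, G₂.adj_symm h]⟩
  loopless := ⟨by
    rintro (x | x) h
    exacts [G₁.loopless.irrefl x h, G₂.loopless.irrefl x h]⟩

section Glue

variable {G₁ : SimpleGraph V₁} {G₂ : SimpleGraph V₂} {a : V₁} {b : V₂}

theorem EveryEdgeCuts.glue (h₁ : G₁.EveryEdgeCuts) (h₂ : G₂.EveryEdgeCuts) :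
    (glue G₁ G₂ a b).EveryEdgeCuts := by
  rintro (u | u) (v | v) huv
  · obtain ⟨p, hu, hv, hp⟩ := h₁ u v huv
    refine ⟨Sum.elim p fun _ => p a, hu, hv, ?_⟩
    rintro (x | x) (y | y) hxy hne hx
    · exact hp x y hxy (fun he => hne (by simpa using he)) hx
    · obtain ⟨rfl, rfl⟩ := hxy
      exact hx
    · obtain ⟨rfl, rfl⟩ := hxy
      exact hx
    · exact hx
  · refine ⟨fun x => x.isLeft, rfl, by simp, ?_⟩
    obtain ⟨rfl, rfl⟩ := huv
    rintro (x | x) (y | y) hxy hne hx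
    · rfl
    · obtain ⟨rfl, rfl⟩ := hxy
      exact absurd rfl hne
    · simp at hx
    · simp at hx
  · refine ⟨fun x => x.isRight, rfl, by simp, ?_⟩
    obtain ⟨rfl, rfl⟩ := huv
    rintro (x | x) (y | y) hxy hne hx
    · simp at hx
    · simp at hx
    · obtain ⟨rfl, rfl⟩ := hxy
      exact absurd rfl hne
    · rfl
  · obtain ⟨p, hu, hv, hp⟩ := h₂ u v huv
    refine ⟨Sum.elim (fun _ => p b) p, hu, hv, ?_⟩
    rintro (x | x) (y | y) hxy hne hx
    · exact hx
    · obtain ⟨rfl, rfl⟩ := hxy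
      exact hx
    · obtain ⟨rfl, rfl⟩ := hxy
      exact hx
    · exact hp x y hxy (fun he => hne (by simpa using he)) hx

/-- The relation on `V₁ ⊕ V₂` given by `R₁` and `R₂` on the two summands, which in addition relates
`a` and `b` if `c` holds. -/
def glueRel (a : V₁) (b : V₂) (c : Prop) (R₁ : V₁ → V₁ → Prop) (R₂ : V₂ → V₂ → Prop) :
    V₁ ⊕ V₂ → V₁ ⊕ V₂ → Prop
  | .inl x, .inl y => R₁ x y
  | .inr x, .inr y => R₂ x y
  | .inl x, .inr y => x = a ∧ y = b ∧ c
  | .inr y, .inl x => x = a ∧ y = b ∧ c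

theorem isMatchingRel_glueRel {c : Prop} {R₁ : V₁ → V₁ → Prop} {R₂ : V₂ → V₂ → Prop} :
    (G₁.glue G₂ a b).IsMatchingRel (glueRel a b c R₁ R₂) ↔
      (G₁.IsMatchingRel R₁ ∧ (c → ∀ y, ¬ R₁ a y)) ∧
      (G₂.IsMatchingRel R₂ ∧ (c → ∀ y, ¬ R₂ b y)) := by
  refine ⟨fun h => ⟨⟨⟨fun x y => h.symm (.inl x) (.inl y), fun x y => h.adj (.inl x) (.inl y),
      fun x y z hy hz => Sum.inl_injective (h.unique (.inl x) (.inl y) (.inl z) hy hz)⟩,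
      fun hc y hy => Sum.inl_ne_inr (h.unique (.inl a) (.inl y) (.inr b) hy ⟨rfl, rfl, hc⟩)⟩,
      ⟨fun x y => h.symm (.inr x) (.inr y), fun x y => h.adj (.inr x) (.inr y),
      fun x y z hy hz => Sum.inr_injective (h.unique (.inr x) (.inr y) (.inr z) hy hz)⟩,
      fun hc y hy => Sum.inr_ne_inl (h.unique (.inr b) (.inr y) (.inl a) hy ⟨rfl, rfl, hc⟩)⟩,
    fun ⟨⟨h₁, k₁⟩, h₂, k₂⟩ => ⟨?_, ?_, ?_⟩⟩
  · rintro (x | x) (y | y) h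
    exacts [h₁.symm _ _ h, h, h, h₂.symm _ _ h]
  · rintro (x | x) (y | y) h
    exacts [h₁.adj _ _ h, ⟨h.1, h.2.1⟩, ⟨h.1, h.2.1⟩, h₂.adj _ _ h]
  · rintro (x | x) (y | y) (z | z) hy hz
    · exact congrArg _ (h₁.unique _ _ _ hy hz)
    · obtain ⟨rfl, rfl, hc⟩ := hz
      exact absurd hy (k₁ hc y)
    · obtain ⟨rfl, rfl, hc⟩ := hy
      exact absurd hz (k₁ hc z)
    · rw [hy.2.1, hz.2.1]
    · rw [hy.1, hz.1]
    · obtain ⟨rfl, rfl, hc⟩ := hy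
      exact absurd hz (k₂ hc z)
    · obtain ⟨rfl, rfl, hc⟩ := hz
      exact absurd hy (k₂ hc y)
    · exact congrArg _ (h₂.unique _ _ _ hy hz)

/-- A matching of `glue G₁ G₂ a b` is recovered from its restrictions to the two summands and from
whether it uses the joining edge. -/
theorem IsMatchingRel.eq_glueRel {R : V₁ ⊕ V₂ → V₁ ⊕ V₂ → Prop} (c : Prop)
    (h : (G₁.glue G₂ a b).IsMatchingRel R) (hc : R (.inl a) (.inr b) ↔ c) :
    glueRel a b c (fun x y => R (.inl x) (.inl y)) (fun x y => R (.inr x) (.inr y)) = R := by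
  funext x y
  rcases x with x | x <;> rcases y with y | y
  · rfl
  · refine propext ⟨fun ⟨hx, hy, h'⟩ => ?_, fun hR => ?_⟩
    · subst hx hy
      exact hc.2 h'
    · obtain ⟨rfl, rfl⟩ := h.adj _ _ hR
      exact ⟨rfl, rfl, hc.1 hR⟩
  · refine propext ⟨fun ⟨hx, hy, h'⟩ => ?_, fun hR => ?_⟩
    · subst hx hy
      exact h.symm _ _ (hc.2 h')
    · obtain ⟨rfl, rfl⟩ := h.adj _ _ hR
      exact ⟨rfl, rfl, hc.1 (h.symm _ _ hR)⟩
  · rfl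

theorem IsMatchingRel.restrict {R : V₁ ⊕ V₂ → V₁ ⊕ V₂ → Prop} (c : Prop)
    (h : (G₁.glue G₂ a b).IsMatchingRel R) (hc : R (.inl a) (.inr b) ↔ c) :
    (G₁.IsMatchingRel (fun x y => R (.inl x) (.inl y)) ∧ (c → ∀ y, ¬ R (.inl a) (.inl y))) ∧
      (G₂.IsMatchingRel (fun x y => R (.inr x) (.inr y)) ∧ (c → ∀ y, ¬ R (.inr b) (.inr y))) := by
  rw [← h.eq_glueRel c hc] at h
  exact isMatchingRel_glueRel.1 h

/-- The matchings of two joined graphs that use the joining edge (if `c` holds) or omit it (if `c`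
fails) are the pairs of matchings of the two parts, which have to leave `a` and `b` uncovered if `c`
holds. The condition `q` restricts the matching of the second part. -/
theorem card_isMatchingRel_glue (c : Prop) (q : (V₂ → V₂ → Prop) → Prop) :
    Nat.card {R : V₁ ⊕ V₂ → V₁ ⊕ V₂ → Prop // ((G₁.glue G₂ a b).IsMatchingRel R ∧
        q fun x y => R (.inr x) (.inr y)) ∧ (R (.inl a) (.inr b) ↔ c)} =
      Nat.card {R₁ : V₁ → V₁ → Prop // G₁.IsMatchingRel R₁ ∧ (c → ∀ y, ¬ R₁ a y)} *
      Nat.card {R₂ : V₂ → V₂ → Prop // (G₂.IsMatchingRel R₂ ∧ (c → ∀ y, ¬ R₂ b y)) ∧ q R₂} := by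
  rw [← Nat.card_prod]
  refine Nat.card_congr
    { toFun := fun R => ⟨⟨_, (R.2.1.1.restrict c R.2.2).1⟩,
        ⟨_, (R.2.1.1.restrict c R.2.2).2, R.2.1.2⟩⟩
      invFun := fun P => ⟨glueRel a b c P.1.1 P.2.1, ⟨isMatchingRel_glueRel.2 ⟨P.1.2, P.2.2.1⟩,
        P.2.2.2⟩, by simp [glueRel]⟩
      left_inv := fun R => Subtype.ext (R.2.1.1.eq_glueRel c R.2.2)
      right_inv := fun P => rfl }

/-- A matching of two graphs joined by an edge either omits the joining edge, or uses it and leaves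
both of its ends uncovered by the remaining edges. -/
theorem hosoyaIndex_glue [Finite V₁] [Finite V₂] :
    hosoyaIndex (G₁.glue G₂ a b) = hosoyaIndex G₁ * hosoyaIndex G₂ +
      G₁.hosoyaIndexAvoiding a * G₂.hosoyaIndexAvoiding b := by
  have h₁ := card_isMatchingRel_glue (G₁ := G₁) (G₂ := G₂) (a := a) (b := b) False fun _ => True
  have h₂ := card_isMatchingRel_glue (G₁ := G₁) (G₂ := G₂) (a := a) (b := b) True fun _ => True
  simp only [and_true, false_imp_iff, iff_false, iff_true, true_imp_iff] at h₁ h₂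
  simp only [hosoyaIndex_eq_card_isMatchingRel, hosoyaIndexAvoiding]
  rw [← h₁, ← h₂, ← Nat.card_congr (Equiv.subtypeSubtypeEquivSubtypeInter _ _),
    ← Nat.card_congr (Equiv.subtypeSubtypeEquivSubtypeInter
      (fun R => (G₁.glue G₂ a b).IsMatchingRel R) fun R => R (.inl a) (.inr b)),
    add_comm, ← Nat.card_sum]
  classical
  exact Nat.card_congr (Equiv.sumCompl _).symm

theorem hosoyaIndexAvoiding_glue :
    (G₁.glue G₂ a b).hosoyaIndexAvoiding (.inr b) =
      hosoyaIndex G₁ * G₂.hosoyaIndexAvoiding b := by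
  have h := card_isMatchingRel_glue (G₁ := G₁) (G₂ := G₂) (a := a) (b := b) False
    fun R => ∀ y, ¬ R b y
  simp only [false_imp_iff, iff_false, and_true] at h
  rw [hosoyaIndex_eq_card_isMatchingRel, hosoyaIndexAvoiding, hosoyaIndexAvoiding, ← h]
  refine Nat.card_congr (Equiv.subtypeEquivRight fun R => ?_)
  refine ⟨fun ⟨hR, hb⟩ => ⟨⟨hR, fun y => hb _⟩, fun h => hb _ (hR.symm _ _ h)⟩,
    fun ⟨⟨hR, hb⟩, h⟩ => ⟨hR, ?_⟩⟩
  rintro (y | y) hy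
  · obtain ⟨rfl, _⟩ := hR.adj _ _ hy
    exact h (hR.symm _ _ hy)
  · exact hb y hy

theorem IsConnSet.inl {S : Set V₁} (h : G₁.IsConnSet S) :
    (G₁.glue G₂ a b).IsConnSet (Sum.inl '' S) := by
  refine ⟨h.nonempty.image _, ?_⟩
  rintro p hp _ ⟨x, hx, rfl⟩ hpx _ ⟨y, hy, rfl⟩
  exact h.spread (fun z => p (.inl z)) (fun z hz w hw hzw =>
    hp _ (Set.mem_image_of_mem _ hz) _ (Set.mem_image_of_mem _ hw) hzw) x hx hpx y hy

theorem IsConnSet.inr {S : Set V₂} (h : G₂.IsConnSet S) :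
    (G₁.glue G₂ a b).IsConnSet (Sum.inr '' S) := by
  refine ⟨h.nonempty.image _, ?_⟩
  rintro p hp _ ⟨x, hx, rfl⟩ hpx _ ⟨y, hy, rfl⟩
  exact h.spread (fun z => p (.inr z)) (fun z hz w hw hzw =>
    hp _ (Set.mem_image_of_mem _ hz) _ (Set.mem_image_of_mem _ hw) hzw) x hx hpx y hy

theorem IsConnSet.union {S₁ : Set V₁} {S₂ : Set V₂} (h₁ : G₁.IsConnSet S₁) (h₂ : G₂.IsConnSet S₂)
    (ha : a ∈ S₁) (hb : b ∈ S₂) :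
    (G₁.glue G₂ a b).IsConnSet (Sum.inl '' S₁ ∪ Sum.inr '' S₂) := by
  refine ⟨⟨_, Or.inl ⟨a, ha, rfl⟩⟩, fun p hp => ?_⟩
  have h1 : ∀ x ∈ S₁, p (.inl x) → ∀ y ∈ S₁, p (.inl y) :=
    h₁.spread (fun z => p (.inl z)) fun z hz w hw hzw =>
      hp _ (Or.inl ⟨z, hz, rfl⟩) _ (Or.inl ⟨w, hw, rfl⟩) hzw
  have h2 : ∀ x ∈ S₂, p (.inr x) → ∀ y ∈ S₂, p (.inr y) :=
    h₂.spread (fun z => p (.inr z)) fun z hz w hw hzw =>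
      hp _ (Or.inr ⟨z, hz, rfl⟩) _ (Or.inr ⟨w, hw, rfl⟩) hzw
  have hab : p (.inl a) → p (.inr b) :=
    hp _ (Or.inl ⟨a, ha, rfl⟩) _ (Or.inr ⟨b, hb, rfl⟩) ⟨rfl, rfl⟩
  have hba : p (.inr b) → p (.inl a) :=
    hp _ (Or.inr ⟨b, hb, rfl⟩) _ (Or.inl ⟨a, ha, rfl⟩) ⟨rfl, rfl⟩
  rintro _ (⟨x, hx, rfl⟩ | ⟨x, hx, rfl⟩) hpx _ (⟨y, hy, rfl⟩ | ⟨y, hy, rfl⟩)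
  · exact h1 x hx hpx y hy
  · exact h2 b hb (hab (h1 x hx hpx a ha)) y hy
  · exact h1 a ha (hba (h2 x hx hpx b hb)) y hy
  · exact h2 x hx hpx y hy

/-- A connected set of two graphs joined by an edge that meets the first graph restricts to a
connected set of it, and contains both ends of the joining edge if it also meets the second. -/
theorem IsConnSet.of_glue_left {S : Set (V₁ ⊕ V₂)} (h : (G₁.glue G₂ a b).IsConnSet S) {x : V₁}
    (hx : .inl x ∈ S) :
    G₁.IsConnSet (Sum.inl ⁻¹' S) ∧
      ∀ y, .inr y ∈ S → (.inl a : V₁ ⊕ V₂) ∈ S ∧ (.inr b : V₁ ⊕ V₂) ∈ S := by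
  refine ⟨⟨⟨x, hx⟩, fun p hp u hu hpu v hv => ?_⟩, fun y hy => ?_⟩
  · -- a part of the first half is extended over the second half by its value at `a`
    refine h.spread (Sum.elim p fun _ => Sum.inl a ∈ S ∧ p a) ?_ _ hu hpu _ hv
    rintro (z | z) hz (w | w) hw hzw hpz
    · exact hp z hz w hw hzw hpz
    · obtain ⟨rfl, rfl⟩ := hzw
      exact ⟨hz, hpz⟩
    · obtain ⟨rfl, rfl⟩ := hzw
      exact hpz.2
    · exact hpz
  · by_contra hab
    have := h.spread (fun z => z.isLeft) ?_ _ hx rfl _ hy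
    · simp at this
    rintro (z | z) hz (w | w) hw hzw hpz
    · rfl
    · obtain ⟨rfl, rfl⟩ := hzw
      exact absurd ⟨hz, hw⟩ hab
    · rfl
    · simp at hpz

theorem IsConnSet.of_glue_right {S : Set (V₁ ⊕ V₂)} (h : (G₁.glue G₂ a b).IsConnSet S) {x : V₂}
    (hx : .inr x ∈ S) : G₂.IsConnSet (Sum.inr ⁻¹' S) := by
  refine ⟨⟨x, hx⟩, fun p hp u hu hpu v hv => ?_⟩
  refine h.spread (Sum.elim (fun _ => Sum.inr b ∈ S ∧ p b) p) ?_ _ hu hpu _ hv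
  rintro (z | z) hz (w | w) hw hzw hpz
  · exact hpz
  · obtain ⟨rfl, rfl⟩ := hzw
    exact hpz.2
  · obtain ⟨rfl, rfl⟩ := hzw
    exact ⟨hz, hpz⟩
  · exact hp z hz w hw hzw hpz

theorem preimage_inl_union (S₁ : Set V₁) (S₂ : Set V₂) :
    Sum.inl ⁻¹' (Sum.inl '' S₁ ∪ Sum.inr '' S₂) = S₁ := by
  ext; simp

theorem preimage_inr_union (S₁ : Set V₁) (S₂ : Set V₂) :
    Sum.inr ⁻¹' (Sum.inl '' S₁ ∪ Sum.inr '' S₂) = S₂ := by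
  ext; simp

/-- A connected set of two joined graphs lies in one of them or is the union of a connected set
through `a` and a connected set through `b`. -/
theorem connSetCount_glue [Finite V₁] [Finite V₂] :
    (G₁.glue G₂ a b).connSetCount = G₁.connSetCount + G₂.connSetCount +
      G₁.connSetCountThrough a * G₂.connSetCountThrough b := by
  simp only [connSetCount, connSetCountThrough]
  rw [← Nat.card_prod, ← Nat.card_sum, ← Nat.card_sum]
  let f : ({S : Set V₁ // G₁.IsConnSet S} ⊕ {S : Set V₂ // G₂.IsConnSet S}) ⊕
      ({S : Set V₁ // G₁.IsConnSet S ∧ a ∈ S} × {S : Set V₂ // G₂.IsConnSet S ∧ b ∈ S}) →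
      {S : Set (V₁ ⊕ V₂) // (G₁.glue G₂ a b).IsConnSet S} :=
    Sum.elim (Sum.elim (fun S => ⟨Sum.inl '' S.1 ∪ Sum.inr '' ∅, by simpa using S.2.inl⟩)
      fun S => ⟨Sum.inl '' ∅ ∪ Sum.inr '' S.1, by simpa using S.2.inr⟩)
      fun S => ⟨_, S.1.2.1.union S.2.2.1 S.1.2.2 S.2.2.2⟩
  refine (Nat.card_congr (Equiv.ofBijective f ⟨fun S T hST => ?_, fun S => ?_⟩)).symm
  · have h1 := congrArg (fun U => Sum.inl ⁻¹' U.1) hST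
    have h2 := congrArg (fun U => Sum.inr ⁻¹' U.1) hST
    rcases S with (S | S) | ⟨S, S'⟩ <;> rcases T with (T | T) | ⟨T, T'⟩ <;>
      simp only [f, Sum.elim_inl, Sum.elim_inr, preimage_inl_union, preimage_inr_union] at h1 h2
    · rw [Subtype.ext h1]
    · exact absurd h1 S.2.nonempty.ne_empty
    · exact absurd h2.symm T'.2.1.nonempty.ne_empty
    · exact absurd h2 S.2.nonempty.ne_empty
    · rw [Subtype.ext h2]
    · exact absurd h1.symm T.2.1.nonempty.ne_empty
    · exact absurd h2 S'.2.1.nonempty.ne_empty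
    · exact absurd h1 S.2.1.nonempty.ne_empty
    · rw [Subtype.ext h1, Subtype.ext h2]
  · have hS := Set.image_preimage_inl_union_image_preimage_inr S.1
    rcases (Sum.inl ⁻¹' S.1).eq_empty_or_nonempty with h1 | ⟨x, hx⟩ <;>
      rcases (Sum.inr ⁻¹' S.1).eq_empty_or_nonempty with h2 | ⟨y, hy⟩
    · rw [h1, h2] at hS
      have := S.2.nonempty.ne_empty
      simp [← hS] at this
    · refine ⟨.inl (.inr ⟨_, S.2.of_glue_right hy⟩), Subtype.ext ?_⟩
      rw [h1] at hS
      exact hS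
    · refine ⟨.inl (.inl ⟨_, (S.2.of_glue_left hx).1⟩), Subtype.ext ?_⟩
      rw [h2] at hS
      exact hS
    · exact ⟨.inr (⟨_, (S.2.of_glue_left hx).1, ((S.2.of_glue_left hx).2 y hy).1⟩,
        ⟨_, S.2.of_glue_right hy, ((S.2.of_glue_left hx).2 y hy).2⟩), Subtype.ext hS⟩

theorem connSetCountThrough_glue [Finite V₁] [Finite V₂] :
    (G₁.glue G₂ a b).connSetCountThrough (.inr b) =
      (1 + G₁.connSetCountThrough a) * G₂.connSetCountThrough b := by
  simp only [connSetCountThrough]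
  rw [one_add_mul, ← Nat.card_prod, ← Nat.card_sum]
  let f : {S : Set V₂ // G₂.IsConnSet S ∧ b ∈ S} ⊕
      ({S : Set V₁ // G₁.IsConnSet S ∧ a ∈ S} × {S : Set V₂ // G₂.IsConnSet S ∧ b ∈ S}) →
      {S : Set (V₁ ⊕ V₂) // (G₁.glue G₂ a b).IsConnSet S ∧ .inr b ∈ S} :=
    Sum.elim (fun S => ⟨Sum.inl '' ∅ ∪ Sum.inr '' S.1, by simpa using S.2.1.inr,
        Or.inr ⟨b, S.2.2, rfl⟩⟩)
      fun S => ⟨_, S.1.2.1.union S.2.2.1 S.1.2.2 S.2.2.2, Or.inr ⟨b, S.2.2.2, rfl⟩⟩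
  refine (Nat.card_congr (Equiv.ofBijective f ⟨fun S T hST => ?_, fun S => ?_⟩)).symm
  · have h1 := congrArg (fun U => Sum.inl ⁻¹' U.1) hST
    have h2 := congrArg (fun U => Sum.inr ⁻¹' U.1) hST
    rcases S with S | ⟨S, S'⟩ <;> rcases T with T | ⟨T, T'⟩ <;>
      simp only [f, Sum.elim_inl, Sum.elim_inr, preimage_inl_union, preimage_inr_union] at h1 h2
    · rw [Subtype.ext h2]
    · exact absurd h1.symm T.2.1.nonempty.ne_empty
    · exact absurd h1 S.2.1.nonempty.ne_empty
    · rw [Subtype.ext h1, Subtype.ext h2]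
  · have hS := Set.image_preimage_inl_union_image_preimage_inr S.1
    have hr := S.2.1.of_glue_right S.2.2
    rcases (Sum.inl ⁻¹' S.1).eq_empty_or_nonempty with h1 | ⟨x, hx⟩
    · refine ⟨.inl ⟨_, hr, S.2.2⟩, Subtype.ext ?_⟩
      rw [h1] at hS
      exact hS
    · exact ⟨.inr (⟨_, (S.2.1.of_glue_left hx).1, ((S.2.1.of_glue_left hx).2 b S.2.2).1⟩,
        ⟨_, hr, S.2.2⟩), Subtype.ext hS⟩

end Glue

/-! ### The graph with one vertex -/

section Subsingleton

variable [Subsingleton V] (G : SimpleGraph V)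

theorem everyEdgeCuts_of_subsingleton : G.EveryEdgeCuts :=
  fun u v h => absurd (Subsingleton.elim u v) h.ne

theorem isMatchingRel_iff_of_subsingleton (R : V → V → Prop) :
    G.IsMatchingRel R ↔ R = fun _ _ => False := by
  refine ⟨fun h => ?_, fun h => ?_⟩
  · funext x y
    exact eq_false fun hxy => (h.adj x y hxy).ne (Subsingleton.elim x y)
  · subst h
    exact ⟨fun _ _ => id, fun _ _ => False.elim, fun _ _ _ => False.elim⟩

theorem hosoyaIndex_of_subsingleton : hosoyaIndex G = 1 := by
  rw [hosoyaIndex_eq_card_isMatchingRel]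
  simp [isMatchingRel_iff_of_subsingleton]

theorem hosoyaIndexAvoiding_of_subsingleton (a : V) : G.hosoyaIndexAvoiding a = 1 := by
  unfold hosoyaIndexAvoiding
  rw [Nat.card_eq_one_iff_unique]
  refine ⟨⟨fun R S => Subtype.ext ?_⟩, ⟨fun _ _ => False, ?_⟩⟩
  · rw [(G.isMatchingRel_iff_of_subsingleton _).1 R.2.1,
      (G.isMatchingRel_iff_of_subsingleton _).1 S.2.1]
  · simp [isMatchingRel_iff_of_subsingleton]

theorem isConnSet_iff_of_subsingleton [Nonempty V] (S : Set V) :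
    G.IsConnSet S ↔ S = Set.univ := by
  refine ⟨fun h => Subsingleton.eq_univ_of_nonempty h.nonempty, fun h => ?_⟩
  subst h
  exact ⟨Set.univ_nonempty, fun p _ x _ hx y _ => Subsingleton.elim x y ▸ hx⟩

theorem connSetCount_of_subsingleton [Nonempty V] : G.connSetCount = 1 := by
  simp [connSetCount, isConnSet_iff_of_subsingleton]

theorem connSetCountThrough_of_subsingleton (a : V) : G.connSetCountThrough a = 1 := by
  have : Nonempty V := ⟨a⟩
  unfold connSetCountThrough
  rw [Nat.card_eq_one_iff_unique]
  refine ⟨⟨fun R S => Subtype.ext ?_⟩, ⟨Set.univ, ?_⟩⟩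
  · rw [(G.isConnSet_iff_of_subsingleton _).1 R.2.1, (G.isConnSet_iff_of_subsingleton _).1 S.2.1]
  · simp [isConnSet_iff_of_subsingleton]

end Subsingleton

end SimpleGraph

/-! ### Recursions for the tree parameters -/

namespace OrderedTree

theorem isChild_root_iff {ts : List OrderedTree} {w : Vertex (node ts)} :
    IsChild Vertex.root w ↔ ∃ i, w = Vertex.inBranch i (rootVertex (ts.get i)) := by
  refine ⟨fun h => ?_, ?_⟩
  · cases h with | ofRoot i => exact ⟨i, rfl⟩
  · rintro ⟨i, rfl⟩
    exact .ofRoot i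

theorem isChild_inBranch_iff {ts : List OrderedTree} {i : Fin ts.length} {u : Vertex (ts.get i)}
    {w : Vertex (node ts)} :
    IsChild (Vertex.inBranch i u) w ↔ ∃ v, w = Vertex.inBranch i v ∧ IsChild u v := by
  refine ⟨fun h => ?_, ?_⟩
  · cases h with | inBranch i h => exact ⟨_, rfl, h⟩
  · rintro ⟨v, rfl, h⟩
    exact .inBranch i h

theorem inBranch_injective {ts : List OrderedTree} {i : Fin ts.length} {u v : Vertex (ts.get i)}
    (h : Vertex.inBranch i u = Vertex.inBranch i v) : u = v := by
  cases h
  rfl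

theorem isChild_inBranch_inBranch_iff {ts : List OrderedTree} {i : Fin ts.length}
    {u v : Vertex (ts.get i)} :
    IsChild (Vertex.inBranch i u) (Vertex.inBranch i v) ↔ IsChild u v := by
  rw [isChild_inBranch_iff]
  refine ⟨?_, fun h => ⟨v, rfl, h⟩⟩
  rintro ⟨w, hw, h⟩
  rwa [inBranch_injective hw]

/-- The vertices of the first branch of a tree. -/
abbrev inFirst (t : OrderedTree) (ts : List OrderedTree) (u : Vertex t) : Vertex (node (t :: ts)) :=
  (vertexConsEquiv t ts).symm (.inl u)

/-- The vertices of a tree outside its first branch. -/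
abbrev inRest (t : OrderedTree) (ts : List OrderedTree) (u : Vertex (node ts)) :
    Vertex (node (t :: ts)) :=
  (vertexConsEquiv t ts).symm (.inr u)

variable {t : OrderedTree} {ts : List OrderedTree}

theorem isChild_inFirst_inFirst {u v : Vertex t} :
    IsChild (inFirst t ts u) (inFirst t ts v) ↔ IsChild u v :=
  isChild_inBranch_inBranch_iff (ts := t :: ts) (i := ⟨0, Nat.succ_pos _⟩)

theorem not_isChild_inFirst_inRest {u : Vertex t} {v : Vertex (node ts)} :
    ¬ IsChild (inFirst t ts u) (inRest t ts v) := by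
  intro h
  obtain ⟨w, hw, -⟩ := (isChild_inBranch_iff (ts := t :: ts) (i := ⟨0, Nat.succ_pos _⟩)).1 h
  exact Sum.inr_ne_inl ((vertexConsEquiv t ts).symm.injective (a₂ := .inl w) hw)

theorem isChild_inRest_inFirst {u : Vertex (node ts)} {v : Vertex t} :
    IsChild (inRest t ts u) (inFirst t ts v) ↔ v = rootVertex t ∧ u = rootVertex (node ts) := by
  constructor
  · intro h
    match u, h with
    | .root, h =>
      obtain ⟨⟨_ | i, hi⟩, hw⟩ := isChild_root_iff.1 h
      · exact ⟨inBranch_injective hw, rfl⟩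
      · cases hw
    | .inBranch ⟨i, hi⟩ u, h =>
      obtain ⟨w, hw, -⟩ :=
        (isChild_inBranch_iff (ts := t :: ts) (i := ⟨i + 1, Nat.succ_lt_succ hi⟩)).1 h
      cases hw
  · rintro ⟨rfl, rfl⟩
    exact isChild_root_iff.2 ⟨⟨0, Nat.succ_pos _⟩, rfl⟩

theorem isChild_inRest_inRest {u v : Vertex (node ts)} :
    IsChild (inRest t ts u) (inRest t ts v) ↔ IsChild u v := by
  constructor
  · intro h
    match u, h with
    | .root, h =>
      obtain ⟨⟨_ | i, hi⟩, hw⟩ := isChild_root_iff.1 h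
      · exact absurd ((vertexConsEquiv t ts).symm.injective (a₂ := .inl (rootVertex t)) hw)
          Sum.inr_ne_inl
      · have : v = .inBranch ⟨i, Nat.lt_of_succ_lt_succ hi⟩ (rootVertex _) :=
          Sum.inr_injective ((vertexConsEquiv t ts).symm.injective hw)
        exact isChild_root_iff.2 ⟨_, this⟩
    | .inBranch ⟨i, hi⟩ u, h =>
      obtain ⟨w, hw, hc⟩ :=
        (isChild_inBranch_iff (ts := t :: ts) (i := ⟨i + 1, Nat.succ_lt_succ hi⟩)).1 h
      have : v = .inBranch ⟨i, hi⟩ w :=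
        Sum.inr_injective ((vertexConsEquiv t ts).symm.injective hw)
      exact isChild_inBranch_iff.2 ⟨w, this, hc⟩
  · intro h
    match u, h with
    | .root, h =>
      obtain ⟨⟨i, hi⟩, rfl⟩ := isChild_root_iff.1 h
      exact isChild_root_iff.2 ⟨⟨i + 1, Nat.succ_lt_succ hi⟩, rfl⟩
    | .inBranch ⟨i, hi⟩ u, h =>
      obtain ⟨w, rfl, hc⟩ := isChild_inBranch_iff.1 h
      exact (isChild_inBranch_iff (ts := t :: ts) (i := ⟨i + 1, Nat.succ_lt_succ hi⟩)).2
        ⟨w, rfl, hc⟩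

/-- Adding a first branch `t` to `node ts` joins the two trees by an edge between their roots. -/
def graphConsIso (t : OrderedTree) (ts : List OrderedTree) : (node (t :: ts)).graph ≃g
    t.graph.glue (node ts).graph (rootVertex t) (rootVertex (node ts)) where
  toEquiv := vertexConsEquiv t ts
  map_rel_iff' := by
    intro u v
    obtain ⟨u, rfl⟩ := (vertexConsEquiv t ts).symm.surjective u
    obtain ⟨v, rfl⟩ := (vertexConsEquiv t ts).symm.surjective v
    rw [Equiv.apply_symm_apply, Equiv.apply_symm_apply]
    simp only [graph, SimpleGraph.fromRel_adj, ne_eq, EmbeddingLike.apply_eq_iff_eq]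
    rcases u with u | u <;> rcases v with v | v
    · change (SimpleGraph.fromRel IsChild).Adj u v ↔ _
      rw [isChild_inFirst_inFirst, isChild_inFirst_inFirst, SimpleGraph.fromRel_adj,
        Sum.inl_injective.eq_iff]
    · change (u = _ ∧ v = _) ↔ _
      rw [isChild_inRest_inFirst]
      simp [not_isChild_inFirst_inRest]
    · change (v = _ ∧ u = _) ↔ _
      rw [isChild_inRest_inFirst]
      simp [not_isChild_inFirst_inRest]
    · change (SimpleGraph.fromRel IsChild).Adj u v ↔ _
      rw [isChild_inRest_inRest, isChild_inRest_inRest, SimpleGraph.fromRel_adj,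
        Sum.inr_injective.eq_iff]

theorem graphConsIso_root (t : OrderedTree) (ts : List OrderedTree) :
    graphConsIso t ts (rootVertex (node (t :: ts))) = .inr (rootVertex (node ts)) :=
  rfl

/-- Induction on ordered trees by splitting off the first branch. -/
theorem cons_induction {P : OrderedTree → Prop} (nil : P (node []))
    (cons : ∀ t ts, P t → P (node ts) → P (node (t :: ts))) : ∀ T, P T
  | node [] => nil
  | node (t :: ts) => cons t ts (cons_induction nil cons t) (cons_induction nil cons (node ts))

theorem everyEdgeCuts_graph (T : OrderedTree) : T.graph.EveryEdgeCuts := by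
  induction T using cons_induction with
  | nil => exact SimpleGraph.everyEdgeCuts_of_subsingleton _
  | cons t ts h₁ h₂ => exact (h₁.glue h₂).congr (graphConsIso t ts)

/-- The number of matchings of `T`. -/
noncomputable def matchings (T : OrderedTree) : ℕ := hosoyaIndex T.graph

/-- The number of matchings of `T` that do not cover the root. -/
noncomputable def rootFreeMatchings (T : OrderedTree) : ℕ :=
  T.graph.hosoyaIndexAvoiding (rootVertex T)

/-- The number of subtrees of `T`. -/
noncomputable def subtrees (T : OrderedTree) : ℕ := subtreeIndex T.graph

/-- The number of subtrees of `T` that contain the root, counted by their vertex sets. -/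
noncomputable def rootSubtrees (T : OrderedTree) : ℕ :=
  T.graph.connSetCountThrough (rootVertex T)

theorem matchings_nil : (node []).matchings = 1 := SimpleGraph.hosoyaIndex_of_subsingleton _

theorem rootFreeMatchings_nil : (node []).rootFreeMatchings = 1 :=
  SimpleGraph.hosoyaIndexAvoiding_of_subsingleton _ _

theorem subtrees_nil : (node []).subtrees = 1 := by
  rw [subtrees, (everyEdgeCuts_graph _).subtreeIndex_eq, SimpleGraph.connSetCount_of_subsingleton]

theorem rootSubtrees_nil : (node []).rootSubtrees = 1 :=
  SimpleGraph.connSetCountThrough_of_subsingleton _ _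

theorem matchings_cons (t : OrderedTree) (ts : List OrderedTree) :
    (node (t :: ts)).matchings = t.matchings * (node ts).matchings +
      t.rootFreeMatchings * (node ts).rootFreeMatchings := by
  rw [matchings, SimpleGraph.hosoyaIndex_congr (graphConsIso t ts), SimpleGraph.hosoyaIndex_glue]
  rfl

theorem rootFreeMatchings_cons (t : OrderedTree) (ts : List OrderedTree) :
    (node (t :: ts)).rootFreeMatchings = t.matchings * (node ts).rootFreeMatchings := by
  rw [rootFreeMatchings, SimpleGraph.hosoyaIndexAvoiding_congr (graphConsIso t ts),
    graphConsIso_root, SimpleGraph.hosoyaIndexAvoiding_glue]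
  rfl

theorem subtrees_cons (t : OrderedTree) (ts : List OrderedTree) :
    (node (t :: ts)).subtrees = t.subtrees + (node ts).subtrees +
      t.rootSubtrees * (node ts).rootSubtrees := by
  simp only [subtrees, (everyEdgeCuts_graph _).subtreeIndex_eq]
  rw [SimpleGraph.connSetCount_congr (graphConsIso t ts), SimpleGraph.connSetCount_glue]
  rfl

theorem rootSubtrees_cons (t : OrderedTree) (ts : List OrderedTree) :
    (node (t :: ts)).rootSubtrees = (1 + t.rootSubtrees) * (node ts).rootSubtrees := by
  rw [rootSubtrees, SimpleGraph.connSetCountThrough_congr (graphConsIso t ts), graphConsIso_root,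
    SimpleGraph.connSetCountThrough_glue]
  rfl

end OrderedTree

/-! ### Sums over all ordered trees -/

theorem HasSum.congr_terms {ι : Type*} {f g : ι → ℂ} {s : ℂ} (h : HasSum f s)
    (hfg : ∀ i, g i = f i) : HasSum g s := by
  rwa [funext hfg]

namespace OrderedTree

/-- The tree obtained from `S` by adding `t` as the first branch at the root. -/
def graft (t : OrderedTree) : OrderedTree → OrderedTree
  | node ts => node (t :: ts)

theorem order_graft (t S : OrderedTree) : (graft t S).order = t.order + S.order := by
  obtain ⟨ts⟩ := S
  exact order_node_cons t ts

theorem matchings_graft (t S : OrderedTree) : (graft t S).matchings =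
    t.matchings * S.matchings + t.rootFreeMatchings * S.rootFreeMatchings := by
  obtain ⟨ts⟩ := S
  exact matchings_cons t ts

theorem rootFreeMatchings_graft (t S : OrderedTree) :
    (graft t S).rootFreeMatchings = t.matchings * S.rootFreeMatchings := by
  obtain ⟨ts⟩ := S
  exact rootFreeMatchings_cons t ts

theorem subtrees_graft (t S : OrderedTree) :
    (graft t S).subtrees = t.subtrees + S.subtrees + t.rootSubtrees * S.rootSubtrees := by
  obtain ⟨ts⟩ := S
  exact subtrees_cons t ts

theorem rootSubtrees_graft (t S : OrderedTree) :
    (graft t S).rootSubtrees = (1 + t.rootSubtrees) * S.rootSubtrees := by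
  obtain ⟨ts⟩ := S
  exact rootSubtrees_cons t ts

/-- An ordered tree is either a single vertex or arises in a unique way by grafting. -/
def graftEquiv : Unit ⊕ OrderedTree × OrderedTree ≃ OrderedTree where
  toFun := Sum.elim (fun _ => node []) fun p => graft p.1 p.2
  invFun
    | node [] => .inl ()
    | node (t :: ts) => .inr (t, node ts)
  left_inv := by
    rintro (_ | ⟨t, ⟨ts⟩⟩) <;> rfl
  right_inv := by
    rintro ⟨_ | ⟨t, ts⟩⟩ <;> rfl

theorem mem_treesOfOrder {T : OrderedTree} {n : ℕ} : T ∈ treesOfOrder n ↔ T.order = n := by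
  simp [treesOfOrder]

/-- The ordered trees with at most `n` vertices. -/
noncomputable def treesUpTo (n : ℕ) : Finset OrderedTree := (finite_order_le n).toFinset

theorem mem_treesUpTo {T : OrderedTree} {n : ℕ} : T ∈ treesUpTo n ↔ T.order ≤ n := by
  simp [treesUpTo]

theorem treesUpTo_zero : treesUpTo 0 = ∅ := by
  ext T
  have := T.order_pos
  simp [mem_treesUpTo]
  omega

theorem exists_subset_treesUpTo (s : Finset OrderedTree) : ∃ n, s ⊆ treesUpTo n :=
  ⟨s.sup order, fun _ hT => mem_treesUpTo.2 (Finset.le_sup hT)⟩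

theorem sum_treesUpTo_succ_le (f : OrderedTree → ℝ) (hf : ∀ T, 0 ≤ f T) (n : ℕ) :
    ∑ T ∈ treesUpTo (n + 1), f T ≤
      f (node []) + ∑ t ∈ treesUpTo n, ∑ S ∈ treesUpTo n, f (graft t S) := by
  let e : OrderedTree × OrderedTree ↪ OrderedTree := ⟨fun p => graft p.1 p.2, fun p q h =>
    Sum.inr_injective (graftEquiv.injective (a₁ := .inr p) (a₂ := .inr q) h)⟩
  have he := Finset.sum_map (treesUpTo n ×ˢ treesUpTo n) e f
  rw [Finset.sum_product] at he
  change _ = ∑ t ∈ treesUpTo n, ∑ S ∈ treesUpTo n, f (graft t S) at he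
  rw [← he, ← Finset.sum_cons (a := node [])]
  · refine Finset.sum_le_sum_of_subset_of_nonneg ?_ fun T _ _ => hf T
    rintro ⟨_ | ⟨t, ts⟩⟩ hT
    · exact Finset.mem_cons_self _ _
    · rw [mem_treesUpTo, order_node_cons] at hT
      have h1 := t.order_pos
      have h2 := (node ts).order_pos
      refine Finset.mem_cons_of_mem (Finset.mem_map.2 ⟨(t, node ts), ?_, rfl⟩)
      rw [Finset.mem_product, mem_treesUpTo, mem_treesUpTo]
      constructor <;> dsimp only <;> omega
  · rw [Finset.mem_map]
    rintro ⟨p, -, hp⟩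
    exact Sum.inr_ne_inl (graftEquiv.injective (a₁ := .inr p) (a₂ := .inl ()) hp)

/-- The generating function `∑_T w(T) z ^ |T|` of a weight `w`. -/
noncomputable def gf (w : OrderedTree → ℕ) (z : ℂ) : ℂ := ∑' T, (w T : ℂ) * z ^ T.order

/-- The sums of `w(T) x ^ |T|` over the trees `T` with at most `n` vertices are bounded by `K`, for
every `n`. For `x ≥ 0` the generating function of `w` then converges absolutely for `|z| ≤ x` and is
bounded by `K` there. -/
def BoundedAt (w : OrderedTree → ℕ) (x K : ℝ) : Prop :=
  ∀ n, ∑ T ∈ treesUpTo n, (w T : ℝ) * x ^ T.order ≤ K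

section BoundedAt

variable {w : OrderedTree → ℕ} {x K : ℝ} {z : ℂ}

theorem BoundedAt.sum_le (h : BoundedAt w x K) (hx : 0 ≤ x) (s : Finset OrderedTree) :
    ∑ T ∈ s, (w T : ℝ) * x ^ T.order ≤ K := by
  obtain ⟨n, hn⟩ := exists_subset_treesUpTo s
  exact (Finset.sum_le_sum_of_subset_of_nonneg hn fun T _ _ => by positivity).trans (h n)

theorem BoundedAt.summable_real (h : BoundedAt w x K) (hx : 0 ≤ x) :
    Summable fun T : OrderedTree => (w T : ℝ) * x ^ T.order :=
  summable_of_sum_le (fun T => by positivity) (h.sum_le hx)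

theorem norm_term_le (hz : ‖z‖ ≤ x) (T : OrderedTree) :
    ‖(w T : ℂ) * z ^ T.order‖ ≤ (w T : ℝ) * x ^ T.order := by
  rw [norm_mul, norm_pow, Complex.norm_natCast]
  gcongr

theorem BoundedAt.summable_norm (h : BoundedAt w x K) (hz : ‖z‖ ≤ x) :
    Summable fun T : OrderedTree => ‖(w T : ℂ) * z ^ T.order‖ :=
  Summable.of_nonneg_of_le (fun _ => norm_nonneg _) (norm_term_le hz)
    (h.summable_real ((norm_nonneg z).trans hz))

theorem BoundedAt.hasSum (h : BoundedAt w x K) (hz : ‖z‖ ≤ x) :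
    HasSum (fun T : OrderedTree => (w T : ℂ) * z ^ T.order) (gf w z) :=
  (h.summable_norm hz).of_norm.hasSum

theorem BoundedAt.norm_gf_le (h : BoundedAt w x K) (hz : ‖z‖ ≤ x) : ‖gf w z‖ ≤ K :=
  have hx := (norm_nonneg z).trans hz
  (tsum_of_norm_bounded (h.summable_real hx).hasSum (norm_term_le hz)).trans
    (Real.tsum_le_of_sum_le (fun T => by positivity) (h.sum_le hx))

theorem BoundedAt.continuousOn (h : BoundedAt w x K) (hx : 0 ≤ x) :
    ContinuousOn (gf w) (Metric.closedBall 0 x) :=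
  continuousOn_tsum (fun T => by fun_prop) (h.summable_real hx) fun T z hz =>
    norm_term_le (by simpa using hz) T

/-- Collecting the trees of equal order turns the sum over all trees into a power series. -/
theorem BoundedAt.hasSum_coeff (h : BoundedAt w x K) (hz : ‖z‖ ≤ x) :
    HasSum (fun n => (∑ T ∈ treesOfOrder n, (w T : ℂ)) * z ^ n) (gf w z) := by
  have hf := (h.hasSum hz).tsum_fiberwise order
  refine (HasSum.congr_terms hf) fun n => ?_
  have hn : order ⁻¹' {n} = (treesOfOrder n : Set OrderedTree) := by
    ext T
    simp [mem_treesOfOrder]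
  rw [hn, Finset.tsum_subtype' (treesOfOrder n) fun T => (w T : ℂ) * z ^ T.order, Finset.sum_mul]
  exact Finset.sum_congr rfl fun T hT => by rw [mem_treesOfOrder.1 hT]

/-- A strict form of the bound for `|gf w z|`: the two smallest trees have orders `1` and `2`, so
that their contributions cannot be aligned unless `z` is a positive real number. -/
theorem BoundedAt.norm_gf_lt (h : BoundedAt w x K) (h₁ : w (node []) = 1)
    (h₂ : w (node [node []]) = 1) (hz : ‖z‖ ≤ x) (hne : z ≠ x) : ‖gf w z‖ < K := by
  classical
  have hx := (norm_nonneg z).trans hz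
  have o₂ : (node [node []]).order = 2 := by rw [order_node_cons, order_node_nil]
  let s : Finset OrderedTree := {node [], node [node []]}
  have hs : ∀ {R : Type} [Semiring R] (y : R),
      ∑ T ∈ s, (w T : R) * y ^ T.order = y + y ^ 2 := fun y => by
    rw [Finset.sum_pair (by simp), h₁, h₂, o₂, order_node_nil]
    simp
  have hre := (h.summable_real hx).sum_add_tsum_subtype_compl s
  have hco := (h.summable_norm hz).of_norm.sum_add_tsum_subtype_compl s
  rw [hs] at hre hco
  have hK : ∑' T : OrderedTree, (w T : ℝ) * x ^ T.order ≤ K :=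
    Real.tsum_le_of_sum_le (fun T => by positivity) (h.sum_le hx)
  have hrest : ‖∑' T : {T // T ∉ s}, (w T : ℂ) * z ^ T.1.order‖ ≤
      ∑' T : {T // T ∉ s}, (w T : ℝ) * x ^ T.1.order :=
    tsum_of_norm_bounded ((h.summable_real hx).subtype _).hasSum fun T => norm_term_le hz T.1
  have hlt : ‖z + z ^ 2‖ < x + x ^ 2 := by
    have h1 : ‖1 + z‖ < 1 + x := by
      refine lt_of_le_of_ne ((norm_add_le _ _).trans (by simpa using hz)) fun he => hne ?_
      have h3 : ‖1 + z‖ ^ 2 = 1 + 2 * z.re + ‖z‖ ^ 2 := by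
        rw [Complex.sq_norm, Complex.sq_norm, Complex.normSq_apply, Complex.normSq_apply]
        simp
        ring
      have h4 := Complex.re_le_norm z
      rw [he] at h3
      have h5 : ‖z‖ ^ 2 ≤ x ^ 2 := by gcongr
      have h6 : z.re = x := by nlinarith
      have h7 : ‖z‖ = x := by linarith
      refine Complex.ext h6 ?_
      have h8 := Complex.sq_norm z
      rw [Complex.normSq_apply, h7, h6] at h8
      simpa using (by nlinarith : z.im ^ 2 = 0)
    have hx0 : 0 < x := by
      refine lt_of_le_of_ne hx fun h0 => hne ?_
      subst h0
      simpa using hz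
    calc ‖z + z ^ 2‖ = ‖z‖ * ‖1 + z‖ := by rw [← norm_mul]; ring_nf
      _ ≤ x * ‖1 + z‖ := by gcongr
      _ < x * (1 + x) := by gcongr
      _ = x + x ^ 2 := by ring
  calc ‖gf w z‖ = ‖(z + z ^ 2) + ∑' T : {T // T ∉ s}, (w T : ℂ) * z ^ T.1.order‖ := by
        rw [hco, gf]
    _ ≤ ‖z + z ^ 2‖ + ∑' T : {T // T ∉ s}, (w T : ℝ) * x ^ T.1.order :=
        (norm_add_le _ _).trans (by gcongr)
    _ < x + x ^ 2 + ∑' T : {T // T ∉ s}, (w T : ℝ) * x ^ T.1.order := by gcongr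
    _ ≤ K := hre.trans_le hK

/-- A weight that is bilinear under grafting has a generating function that is bilinear in the
generating functions of the constituent weights. -/
theorem BoundedAt.gf_eq {ι : Type*} [Fintype ι] {u v : ι → OrderedTree → ℕ}
    (h : BoundedAt w x K) (hu : ∀ i, ∃ L, BoundedAt (u i) x L)
    (hv : ∀ i, ∃ M, BoundedAt (v i) x M) (hnil : w (node []) = 1)
    (hw : ∀ t S, w (graft t S) = ∑ i, u i t * v i S) (hz : ‖z‖ ≤ x) :
    gf w z = z + ∑ i, gf (u i) z * gf (v i) z := by
  have h1 : HasSum (fun p : OrderedTree × OrderedTree =>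
      (w (graft p.1 p.2) : ℂ) * z ^ (graft p.1 p.2).order) (∑ i, gf (u i) z * gf (v i) z) := by
    have h2 : ∀ i ∈ Finset.univ, HasSum (fun p : OrderedTree × OrderedTree =>
        ((u i p.1 : ℂ) * z ^ p.1.order) * ((v i p.2 : ℂ) * z ^ p.2.order))
        (gf (u i) z * gf (v i) z) := fun i _ => by
      obtain ⟨L, hu⟩ := hu i
      obtain ⟨M, hv⟩ := hv i
      have h3 := summable_mul_of_summable_norm (hu.summable_norm hz) (hv.summable_norm hz)
      have h4 := tsum_mul_tsum_of_summable_norm (hu.summable_norm hz) (hv.summable_norm hz)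
      rw [gf, gf, h4]
      exact h3.hasSum
    refine (hasSum_sum h2).congr_terms fun p => ?_
    rw [hw, order_graft, pow_add, Nat.cast_sum, Finset.sum_mul]
    refine Finset.sum_congr rfl fun i _ => ?_
    push_cast
    ring
  have h3 : HasSum (fun _ : Unit => (w (node []) : ℂ) * z ^ (node []).order) z := by
    rw [hnil, order_node_nil]
    simp
  refine (h.hasSum hz).unique (graftEquiv.hasSum_iff.1 (HasSum.sum ?_ ?_))
  · exact h3
  · exact h1

/-- If a tree with at most `n + 1` vertices is `graft t S`, then `t` and `S` have at most `n`
vertices; this is the step of the induction that bounds the partial sums. -/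
theorem sum_treesUpTo_succ_weight_le {ι : Type*} [Fintype ι] {u v : ι → OrderedTree → ℕ} (n : ℕ)
    (hx : 0 ≤ x) (hnil : w (node []) = 1) (hw : ∀ t S, w (graft t S) = ∑ i, u i t * v i S) :
    ∑ T ∈ treesUpTo (n + 1), (w T : ℝ) * x ^ T.order ≤ x + ∑ i,
      (∑ T ∈ treesUpTo n, (u i T : ℝ) * x ^ T.order) *
        ∑ T ∈ treesUpTo n, (v i T : ℝ) * x ^ T.order := by
  refine (sum_treesUpTo_succ_le _ (fun T => by positivity) n).trans (le_of_eq ?_)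
  congr 1
  · simp [hnil, order_node_nil]
  · simp_rw [Finset.sum_mul_sum]
    symm
    rw [Finset.sum_comm]
    refine Finset.sum_congr rfl fun t _ => ?_
    rw [Finset.sum_comm]
    refine Finset.sum_congr rfl fun S _ => ?_
    rw [hw, order_graft, pow_add, Nat.cast_sum, Finset.sum_mul]
    refine Finset.sum_congr rfl fun i _ => ?_
    push_cast
    ring

end BoundedAt

end OrderedTree

/-! ### The six generating functions at the critical point -/

namespace OrderedTree

/-- The weight `Z(T) r(T)`, where `r` counts the subtrees containing the root. -/
noncomputable def matchingsRoot (T : OrderedTree) : ℕ := T.matchings * T.rootSubtrees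

/-- The weight `Z₀(T) r(T)`, where `Z₀` counts the matchings avoiding the root and `r` the subtrees
containing it. -/
noncomputable def rootFreeRoot (T : OrderedTree) : ℕ := T.rootFreeMatchings * T.rootSubtrees

/-- The weight `Z(T) ρ(T)`. -/
noncomputable def matchingsSub (T : OrderedTree) : ℕ := T.matchings * T.subtrees

/-- The weight `Z₀(T) ρ(T)`, where `Z₀` counts the matchings avoiding the root. -/
noncomputable def rootFreeSub (T : OrderedTree) : ℕ := T.rootFreeMatchings * T.subtrees

theorem matchings_graft_sum (t S : OrderedTree) : (graft t S).matchings =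
    ∑ i, ![matchings, rootFreeMatchings] i t * ![matchings, rootFreeMatchings] i S := by
  simp [Fin.sum_univ_succ, matchings_graft]

theorem rootFreeMatchings_graft_sum (t S : OrderedTree) : (graft t S).rootFreeMatchings =
    ∑ i, ![matchings] i t * ![rootFreeMatchings] i S := by
  simp [rootFreeMatchings_graft]

theorem matchingsRoot_graft_sum (t S : OrderedTree) : (graft t S).matchingsRoot =
    ∑ i, ![matchings, matchingsRoot, rootFreeMatchings, rootFreeRoot] i t *
      ![matchingsRoot, matchingsRoot, rootFreeRoot, rootFreeRoot] i S := by
  simp [Fin.sum_univ_succ, matchingsRoot, rootFreeRoot, matchings_graft, rootSubtrees_graft]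
  ring

theorem rootFreeRoot_graft_sum (t S : OrderedTree) : (graft t S).rootFreeRoot =
    ∑ i, ![matchings, matchingsRoot] i t * ![rootFreeRoot, rootFreeRoot] i S := by
  simp [Fin.sum_univ_succ, matchingsRoot, rootFreeRoot, rootFreeMatchings_graft,
    rootSubtrees_graft]
  ring

theorem matchingsSub_graft_sum (t S : OrderedTree) : (graft t S).matchingsSub =
    ∑ i, ![matchingsSub, matchings, matchingsRoot, rootFreeSub, rootFreeMatchings,
        rootFreeRoot] i t *
      ![matchings, matchingsSub, matchingsRoot, rootFreeMatchings, rootFreeSub,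
        rootFreeRoot] i S := by
  simp [Fin.sum_univ_succ, matchingsRoot, rootFreeRoot, matchingsSub, rootFreeSub,
    matchings_graft, subtrees_graft]
  ring

theorem rootFreeSub_graft_sum (t S : OrderedTree) : (graft t S).rootFreeSub =
    ∑ i, ![matchingsSub, matchings, matchingsRoot] i t *
      ![rootFreeMatchings, rootFreeSub, rootFreeRoot] i S := by
  simp [Fin.sum_univ_succ, matchingsRoot, rootFreeRoot, matchingsSub, rootFreeSub,
    rootFreeMatchings_graft, subtrees_graft]
  ring

theorem matchingsRoot_nil : (node []).matchingsRoot = 1 := by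
  rw [matchingsRoot, matchings_nil, rootSubtrees_nil]

theorem rootFreeRoot_nil : (node []).rootFreeRoot = 1 := by
  rw [rootFreeRoot, rootFreeMatchings_nil, rootSubtrees_nil]

theorem matchingsSub_nil : (node []).matchingsSub = 1 := by
  rw [matchingsSub, matchings_nil, subtrees_nil]

theorem rootFreeSub_nil : (node []).rootFreeSub = 1 := by
  rw [rootFreeSub, rootFreeMatchings_nil, subtrees_nil]

/-- The dominant singularity `z₀`. -/
noncomputable def critZ : ℝ := (7 + 3 * √5) / 128

theorem sqrt_five_sq : √5 ^ 2 = 5 := Real.sq_sqrt (by norm_num)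

theorem sqrt_five_gt : 2.236 < √5 := Real.lt_sqrt_of_sq_lt (by norm_num)

theorem sqrt_five_lt : √5 < 2.2361 := by
  rw [Real.sqrt_lt' (by norm_num)]
  norm_num

theorem critZ_pos : 0 < critZ := by
  unfold critZ
  positivity

/-- The six polynomial equations satisfied by the generating functions have the stated nonnegative
solution at `z₀`, and by induction on `n` it bounds the sums over the trees of order at most `n`. -/
theorem boundedAt_critZ_all :
    BoundedAt matchings critZ ((9 - 3 * √5) / 16) ∧
    BoundedAt rootFreeMatchings critZ (1 / 8) ∧
    BoundedAt matchingsRoot critZ ((3 + √5) / 16) ∧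
    BoundedAt rootFreeRoot critZ ((1 + √5) / 16) ∧
    BoundedAt matchingsSub critZ ((211 + 93 * √5) / 928) ∧
    BoundedAt rootFreeSub critZ ((99 + 67 * √5) / 928) := by
  have hx := critZ_pos.le
  have h5 := sqrt_five_sq
  have h5' := sqrt_five_lt
  have h5'' := sqrt_five_gt
  simp only [BoundedAt, ← forall_and]
  intro n
  induction n with
  | zero =>
    simp only [treesUpTo_zero, Finset.sum_empty]
    refine ⟨?_, ?_, ?_, ?_, ?_, ?_⟩ <;> linarith
  | succ n ih =>
    obtain ⟨hC, hD, hA, hB, hE, hF⟩ := ih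
    have nonneg : ∀ w : OrderedTree → ℕ, 0 ≤ ∑ T ∈ treesUpTo n, (w T : ℝ) * critZ ^ T.order :=
      fun w => Finset.sum_nonneg fun T _ => by positivity
    have pC := nonneg matchings
    have pD := nonneg rootFreeMatchings
    have pA := nonneg matchingsRoot
    have pB := nonneg rootFreeRoot
    have pE := nonneg matchingsSub
    have pF := nonneg rootFreeSub
    have hz : critZ = (7 + 3 * √5) / 128 := rfl
    refine ⟨(sum_treesUpTo_succ_weight_le n hx matchings_nil matchings_graft_sum).trans ?_,
      (sum_treesUpTo_succ_weight_le n hx rootFreeMatchings_nil rootFreeMatchings_graft_sum).trans ?_,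
      (sum_treesUpTo_succ_weight_le n hx matchingsRoot_nil matchingsRoot_graft_sum).trans ?_,
      (sum_treesUpTo_succ_weight_le n hx rootFreeRoot_nil rootFreeRoot_graft_sum).trans ?_,
      (sum_treesUpTo_succ_weight_le n hx matchingsSub_nil matchingsSub_graft_sum).trans ?_,
      (sum_treesUpTo_succ_weight_le n hx rootFreeSub_nil rootFreeSub_graft_sum).trans ?_⟩ <;>
    simp only [Fin.sum_univ_succ, Finset.univ_unique, Fin.default_eq_zero, Finset.sum_singleton,
      Matrix.cons_val_zero, Matrix.cons_val_succ] <;>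
    generalize (∑ T ∈ treesUpTo n, (matchings T : ℝ) * critZ ^ T.order) = C at * <;>
    generalize (∑ T ∈ treesUpTo n, (rootFreeMatchings T : ℝ) * critZ ^ T.order) = D at * <;>
    generalize (∑ T ∈ treesUpTo n, (matchingsRoot T : ℝ) * critZ ^ T.order) = A at * <;>
    generalize (∑ T ∈ treesUpTo n, (rootFreeRoot T : ℝ) * critZ ^ T.order) = B at * <;>
    generalize (∑ T ∈ treesUpTo n, (matchingsSub T : ℝ) * critZ ^ T.order) = E at * <;>
    generalize (∑ T ∈ treesUpTo n, (rootFreeSub T : ℝ) * critZ ^ T.order) = F at * <;>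
    rw [hz]
    · have h1 := mul_le_mul hC hC pC (pC.trans hC)
      have h2 := mul_le_mul hD hD pD (pD.trans hD)
      linarith
    · have h1 := mul_le_mul hC hD pD (pC.trans hC)
      linarith
    · have h1 := mul_le_mul hC hA pA (pC.trans hC)
      have h2 := mul_le_mul hA hA pA (pA.trans hA)
      have h3 := mul_le_mul hD hB pB (pD.trans hD)
      have h4 := mul_le_mul hB hB pB (pB.trans hB)
      linarith
    · have h1 := mul_le_mul hC hB pB (pC.trans hC)
      have h2 := mul_le_mul hA hB pB (pA.trans hA)
      linarith
    · have h1 := mul_le_mul hE hC pC (pE.trans hE)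
      have h2 := mul_le_mul hA hA pA (pA.trans hA)
      have h3 := mul_le_mul hF hD pD (pF.trans hF)
      have h4 := mul_le_mul hB hB pB (pB.trans hB)
      linarith
    · have h1 := mul_le_mul hE hD pD (pE.trans hE)
      have h2 := mul_le_mul hC hF pF (pC.trans hC)
      have h3 := mul_le_mul hA hB pB (pA.trans hA)
      linarith

/-- The polynomial system satisfied by the six generating functions on `|z| ≤ z₀`. -/
theorem gf_system {z : ℂ} (hz : ‖z‖ ≤ critZ) :
    gf matchings z = z + gf matchings z ^ 2 + gf rootFreeMatchings z ^ 2 ∧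
    gf rootFreeMatchings z = z + gf matchings z * gf rootFreeMatchings z ∧
    gf matchingsRoot z = z + gf matchings z * gf matchingsRoot z + gf matchingsRoot z ^ 2 +
      gf rootFreeMatchings z * gf rootFreeRoot z + gf rootFreeRoot z ^ 2 ∧
    gf rootFreeRoot z = z + gf matchings z * gf rootFreeRoot z +
      gf matchingsRoot z * gf rootFreeRoot z ∧
    gf matchingsSub z = z + 2 * gf matchingsSub z * gf matchings z + gf matchingsRoot z ^ 2 +
      2 * gf rootFreeSub z * gf rootFreeMatchings z + gf rootFreeRoot z ^ 2 ∧
    gf rootFreeSub z = z + gf matchingsSub z * gf rootFreeMatchings z +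
      gf matchings z * gf rootFreeSub z + gf matchingsRoot z * gf rootFreeRoot z := by
  obtain ⟨hC, hD, hA, hB, hE, hF⟩ := boundedAt_critZ_all
  have hC' := Exists.intro _ hC
  have hD' := Exists.intro _ hD
  have hA' := Exists.intro _ hA
  have hB' := Exists.intro _ hB
  have hE' := Exists.intro _ hE
  have hF' := Exists.intro _ hF
  have eC := hC.gf_eq (by simp [Fin.forall_fin_succ, *]) (by simp [Fin.forall_fin_succ, *])
    matchings_nil matchings_graft_sum hz
  have eD := hD.gf_eq (by simp [*]) (by simp [*])
    rootFreeMatchings_nil rootFreeMatchings_graft_sum hz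
  have eA := hA.gf_eq (by simp [Fin.forall_fin_succ, *]) (by simp [Fin.forall_fin_succ, *])
    matchingsRoot_nil matchingsRoot_graft_sum hz
  have eB := hB.gf_eq (by simp [Fin.forall_fin_succ, *]) (by simp [Fin.forall_fin_succ, *])
    rootFreeRoot_nil rootFreeRoot_graft_sum hz
  have eE := hE.gf_eq (by simp [Fin.forall_fin_succ, *]) (by simp [Fin.forall_fin_succ, *])
    matchingsSub_nil matchingsSub_graft_sum hz
  have eF := hF.gf_eq (by simp [Fin.forall_fin_succ, *]) (by simp [Fin.forall_fin_succ, *])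
    rootFreeSub_nil rootFreeSub_graft_sum hz
  simp only [Fin.sum_univ_succ, Finset.univ_unique, Fin.default_eq_zero, Finset.sum_singleton,
    Matrix.cons_val_zero, Matrix.cons_val_succ] at eC eD eA eB eE eF
  refine ⟨?_, ?_, ?_, ?_, ?_, ?_⟩
  · linear_combination eC
  · linear_combination eD
  · linear_combination eA
  · linear_combination eB
  · linear_combination eE
  · linear_combination eF

/-! ### The number of ordered trees -/

/-- The generating function of all ordered trees converges for `|z| ≤ 1/4`, where it is at most
`1/2`. -/
theorem boundedAt_one : BoundedAt (fun _ => 1) (1 / 4) (1 / 2) := by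
  intro n
  induction n with
  | zero => norm_num [treesUpTo_zero]
  | succ n ih =>
    refine (sum_treesUpTo_succ_weight_le (ι := Unit) (u := fun _ _ => 1) (v := fun _ _ => 1) n
      (by norm_num) rfl (fun _ _ => by simp)).trans ?_
    have h := Finset.sum_nonneg (s := treesUpTo n)
      fun T _ => (by positivity : (0 : ℝ) ≤ ((1 : ℕ) : ℝ) * (1 / 4) ^ T.order)
    have h1 := mul_le_mul ih ih h (h.trans ih)
    simp only [Finset.univ_unique, Finset.sum_singleton]
    linarith

theorem gf_one_eq {z : ℂ} (hz : ‖z‖ ≤ 1 / 4) :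
    gf (fun _ => 1) z = z + gf (fun _ => 1) z ^ 2 := by
  have h := boundedAt_one.gf_eq (ι := Unit) (u := fun _ _ => 1) (v := fun _ _ => 1)
    (fun _ => ⟨_, boundedAt_one⟩) (fun _ => ⟨_, boundedAt_one⟩) rfl (fun _ _ => by simp) hz
  simpa [sq] using h

/-- The binary tree that corresponds to an ordered tree: the left subtree encodes the first branch,
the right subtree the tree that remains without it. -/
def toBinary : OrderedTree → BinaryTree Unit
  | node [] => .nil
  | node (t :: ts) => .node () (toBinary t) (toBinary (node ts))

/-- The inverse of `toBinary`. -/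
def ofBinary : BinaryTree Unit → OrderedTree
  | .nil => node []
  | .node _ l r => graft (ofBinary l) (ofBinary r)

theorem ofBinary_toBinary (T : OrderedTree) : ofBinary (toBinary T) = T := by
  induction T using cons_induction with
  | nil => rw [toBinary, ofBinary]
  | cons t ts h₁ h₂ => rw [toBinary, ofBinary, h₁, h₂, graft]

theorem toBinary_graft (t S : OrderedTree) :
    toBinary (graft t S) = .node () (toBinary t) (toBinary S) := by
  obtain ⟨ts⟩ := S
  rw [graft, toBinary]

theorem toBinary_ofBinary (B : BinaryTree Unit) : toBinary (ofBinary B) = B := by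
  induction B with
  | nil => rw [ofBinary, toBinary]
  | node _ l r h₁ h₂ => rw [ofBinary, toBinary_graft, h₁, h₂]

theorem order_eq_numNodes (T : OrderedTree) : T.order = (toBinary T).numNodes + 1 := by
  induction T using cons_induction with
  | nil => rw [toBinary, order_node_nil, BinaryTree.numNodes]
  | cons t ts h₁ h₂ =>
    rw [toBinary, order_node_cons, h₁, h₂, BinaryTree.numNodes]
    omega

theorem card_treesOfOrder_succ (n : ℕ) : (treesOfOrder (n + 1)).card = catalan n := by
  rw [← BinaryTree.treesOfNumNodesEq_card_eq_catalan]
  refine Finset.card_nbij' toBinary ofBinary (fun T hT => ?_) (fun B hB => ?_)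
    (fun T _ => ofBinary_toBinary T) fun B _ => toBinary_ofBinary B
  · have := mem_treesOfOrder.1 (Finset.mem_coe.1 hT)
    rw [order_eq_numNodes] at this
    simpa [BinaryTree.mem_treesOfNumNodesEq] using this
  · have := BinaryTree.mem_treesOfNumNodesEq.1 (Finset.mem_coe.1 hB)
    simp [mem_treesOfOrder, order_eq_numNodes, toBinary_ofBinary, this]

end OrderedTree

/-! ### The principal square root -/

theorem Complex.cpow_half_sq (w : ℂ) : (w ^ (1 / 2 : ℂ)) ^ 2 = w := by
  rw [one_div]
  exact Complex.cpow_nat_inv_pow w two_ne_zero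

theorem Complex.eq_cpow_half {w y : ℂ} (hw : 0 < w.re) (h : w ^ 2 = y) : y ^ (1 / 2 : ℂ) = w := by
  rw [one_div, ← h]
  exact Complex.sq_cpow_two_inv hw

theorem one_sub_div_re_pos {R : ℝ} (hR : 0 < R) {z : ℂ} (hz : ‖z‖ ≤ R) (hne : z ≠ R) :
    0 < (1 - z / (R : ℂ)).re := by
  have h1 : (1 - z / (R : ℂ)).re = 1 - z.re / R := by
    rw [Complex.sub_re, Complex.div_ofReal_re, Complex.one_re]
  rw [h1, sub_pos, div_lt_one hR]
  refine lt_of_le_of_ne ((Complex.re_le_norm z).trans hz) fun he => hne ?_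
  have h2 := Complex.sq_norm z
  have h3 : ‖z‖ = R := le_antisymm hz (he ▸ Complex.re_le_norm z)
  rw [Complex.normSq_apply, h3, he] at h2
  exact Complex.ext he (by simpa using (by nlinarith : z.im ^ 2 = 0))

theorem analyticAt_sqrt_one_sub_div {R : ℝ} (hR : 0 < R) {z : ℂ} (hz : ‖z‖ ≤ R) (hne : z ≠ R) :
    AnalyticAt ℂ (fun z : ℂ => (1 - z / (R : ℂ)) ^ (1 / 2 : ℂ)) z :=
  AnalyticAt.cpow (by fun_prop) analyticAt_const (Or.inl (one_sub_div_re_pos hR hz hne))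

theorem tendsto_sqrt_one_sub_div {R : ℝ} (hR : 0 < R) :
    Tendsto (fun z : ℂ => (1 - z / (R : ℂ)) ^ (1 / 2 : ℂ)) (𝓝 (R : ℂ)) (𝓝 0) := by
  have h : Tendsto (fun z : ℂ => ‖(1 - z / (R : ℂ)) ^ (1 / 2 : ℂ)‖ ^ 2) (𝓝 (R : ℂ)) (𝓝 0) := by
    have h1 : Tendsto (fun z : ℂ => ‖1 - z / (R : ℂ)‖) (𝓝 (R : ℂ)) (𝓝 ‖1 - (R : ℂ) / (R : ℂ)‖) :=
      (by fun_prop : Continuous fun z : ℂ => ‖1 - z / (R : ℂ)‖).tendsto _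
    rw [div_self (by exact_mod_cast hR.ne'), sub_self, norm_zero] at h1
    refine h1.congr fun z => ?_
    rw [← norm_pow, Complex.cpow_half_sq]
  rw [tendsto_zero_iff_norm_tendsto_zero]
  have h2 := h.sqrt
  simpa [Real.sqrt_sq] using h2

namespace OrderedTree

/-- The generating function of the numbers of ordered trees. The bound `|T| ≤ 1/2` selects the
principal branch of the square root. -/
theorem hasSum_card_treesOfOrder {y : ℂ} (hy : ‖y‖ < 1 / 4) :
    HasSum (fun n => ((treesOfOrder n).card : ℂ) * y ^ n)
      ((1 - (1 - 4 * y) ^ (1 / 2 : ℂ)) / 2) := by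
  have hs := boundedAt_one.hasSum_coeff hy.le
  have hn := boundedAt_one.norm_gf_le hy.le
  have he := gf_one_eq hy.le
  generalize gf (fun _ => 1) y = T at hs hn he
  have hsq : (1 - 2 * T) ^ 2 = 1 - 4 * y := by linear_combination -4 * he
  have hre : 0 < (1 - 2 * T).re := by
    have h1 : 0 ≤ (1 - 2 * T).re := by
      have := Complex.re_le_norm T
      simp
      linarith
    refine lt_of_le_of_ne h1 fun h0 => ?_
    have h2 := congrArg Complex.re hsq
    have h3 := Complex.re_le_norm y
    rw [sq, Complex.mul_re, ← h0] at h2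
    have h4 : (1 - 4 * y).re = 1 - 4 * y.re := by simp
    rw [h4] at h2
    nlinarith [sq_nonneg (1 - 2 * T).im]
  rw [Complex.eq_cpow_half hre hsq]
  convert! hs using 1
  · simp
  · ring

end OrderedTree

open OrderedTree in
/-- The coefficients of `√(1 - z / R)`, expressed by the numbers of ordered trees. -/
noncomputable def sqrtCoeff (R : ℝ) (n : ℕ) : ℂ :=
  (if n = 0 then 1 else 0) - 2 * ((treesOfOrder n).card / (4 * R) ^ n)

theorem sqrtCoeff_succ (R : ℝ) (n : ℕ) :
    sqrtCoeff R (n + 1) = -2 * (catalan n / (4 * R) ^ (n + 1)) := by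
  simp [sqrtCoeff, OrderedTree.card_treesOfOrder_succ]

theorem hasSum_sqrtCoeff {R : ℝ} (hR : 0 < R) {z : ℂ} (hz : ‖z‖ < R) :
    HasSum (fun n => sqrtCoeff R n * z ^ n) ((1 - z / (R : ℂ)) ^ (1 / 2 : ℂ)) := by
  have hR' : (R : ℂ) ≠ 0 := by exact_mod_cast hR.ne'
  have hy : ‖z / (4 * R)‖ < 1 / 4 := by
    rw [norm_div, norm_mul, Complex.norm_real, Real.norm_of_nonneg hR.le, Complex.norm_ofNat,
      div_lt_div_iff₀ (by positivity) (by norm_num)]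
    linarith
  have h1 := (OrderedTree.hasSum_card_treesOfOrder hy).mul_left 2
  have h2 : HasSum (fun n : ℕ => (if n = 0 then (1 : ℂ) else 0)) 1 := by
    simpa using hasSum_ite_eq (0 : ℕ) (1 : ℂ)
  have h3 := h2.sub h1
  have e : 4 * (z / (4 * R)) = z / R := by field_simp
  rw [e] at h3
  have e2 : (1 : ℂ) - 2 * ((1 - (1 - z / (R : ℂ)) ^ (1 / 2 : ℂ)) / 2) =
    (1 - z / (R : ℂ)) ^ (1 / 2 : ℂ) := by ring
  rw [e2] at h3
  refine h3.congr_terms fun n => ?_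
  rw [sqrtCoeff, div_pow, sub_mul]
  congr 1
  · rcases n with _ | n <;> simp
  · ring

/-! ### Coefficients of a power series with bounded second derivative -/

theorem le_radius_ofScalars {b : ℕ → ℂ} {R : ℝ}
    (hsum : ∀ z : ℂ, ‖z‖ < R → Summable fun n => b n * z ^ n) :
    ENNReal.ofReal R ≤ (FormalMultilinearSeries.ofScalars ℂ b).radius := by
  refine ENNReal.le_of_forall_nnreal_lt fun r hr => ?_
  have hr' : (r : ℝ) < R := by
    rw [← ENNReal.ofReal_coe_nnreal] at hr
    exact (ENNReal.ofReal_lt_ofReal_iff_of_nonneg r.2).1 hr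
  have h := hsum (r : ℝ) (by simpa using hr')
  refine FormalMultilinearSeries.le_radius_of_tendsto _ (l := 0) ?_
  have h2 := h.tendsto_atTop_zero.norm
  simpa [FormalMultilinearSeries.ofScalars_norm] using h2

theorem hasFPowerSeriesOnBall_ofScalars {b : ℕ → ℂ} {g : ℂ → ℂ} {R : ℝ} (hR : 0 < R)
    (hsum : ∀ z : ℂ, ‖z‖ < R → HasSum (fun n => b n * z ^ n) (g z)) :
    HasFPowerSeriesOnBall g (FormalMultilinearSeries.ofScalars ℂ b) 0 (ENNReal.ofReal R) where
  r_le := le_radius_ofScalars fun z hz => (hsum z hz).summable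
  r_pos := by simpa using hR
  hasSum := by
    intro y hy
    have hy' : ‖y‖ < R := by simpa [Metric.eball_ofReal] using hy
    simpa [FormalMultilinearSeries.ofScalars_apply_eq, mul_comm] using hsum y hy'

theorem analyticAt_of_hasSum {b : ℕ → ℂ} {g : ℂ → ℂ} {R : ℝ} (hR : 0 < R)
    (hsum : ∀ z : ℂ, ‖z‖ < R → HasSum (fun n => b n * z ^ n) (g z)) {z : ℂ} (hz : ‖z‖ < R) :
    AnalyticAt ℂ g z :=
  (hasFPowerSeriesOnBall_ofScalars hR hsum).analyticAt_of_mem (by simpa [Metric.eball_ofReal] using hz)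

/-- Cauchy's estimate, applied to the second derivative. -/
theorem norm_coeff_le_of_deriv_deriv_le {b : ℕ → ℂ} {g : ℂ → ℂ} {R K : ℝ} (hR : 0 < R)
    (hsum : ∀ z : ℂ, ‖z‖ < R → HasSum (fun n => b n * z ^ n) (g z))
    (hK : ∀ z : ℂ, ‖z‖ < R → ‖deriv (deriv g) z‖ ≤ K) (n : ℕ) :
    (n + 2) * (n + 1) * ‖b (n + 2)‖ * R ^ n ≤ K := by
  have hp := hasFPowerSeriesOnBall_ofScalars hR hsum
  have hb : b (n + 2) = iteratedDeriv (n + 2) g 0 / (n + 2).factorial := by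
    have h1 := hp.hasFPowerSeriesAt.eq_formalMultilinearSeries hp.analyticAt.hasFPowerSeriesAt
    have h2 := congrArg (fun p => FormalMultilinearSeries.coeff p (n + 2)) h1
    simpa [FormalMultilinearSeries.coeff_ofScalars] using h2
  have hit : iteratedDeriv (n + 2) g 0 = iteratedDeriv n (deriv (deriv g)) 0 := by
    rw [iteratedDeriv_succ', iteratedDeriv_succ']
  have hr : ∀ r : ℝ, 0 < r → r < R → (n + 2) * (n + 1) * ‖b (n + 2)‖ * r ^ n ≤ K := by
    intro r hr hrR
    have han : ∀ z ∈ Metric.ball (0 : ℂ) R, AnalyticAt ℂ (deriv (deriv g)) z := fun z hz =>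
      (analyticAt_of_hasSum hR hsum (by simpa using hz)).deriv.deriv
    have hd : DiffContOnCl ℂ (deriv (deriv g)) (Metric.ball 0 r) := by
      refine DifferentiableOn.diffContOnCl fun z hz => ?_
      have hz' : z ∈ Metric.closedBall (0 : ℂ) r := Metric.closure_ball_subset_closedBall hz
      exact (han z (Metric.closedBall_subset_ball hrR hz')).differentiableAt.differentiableWithinAt
    have hC := Complex.norm_iteratedDeriv_le_of_forall_mem_sphere_norm_le n hr hd fun z hz =>
      hK z (by rw [mem_sphere_zero_iff_norm.1 hz]; exact hrR)
    rw [hb, hit, norm_div, Complex.norm_natCast, Nat.factorial_succ, Nat.factorial_succ]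
    rw [le_div_iff₀ (by positivity)] at hC
    have hf : (0 : ℝ) < n.factorial := by positivity
    push_cast
    calc _ = ‖iteratedDeriv n (deriv (deriv g)) 0‖ * r ^ n / n.factorial := by field_simp; ring
      _ ≤ n.factorial * K / n.factorial := by gcongr
      _ = K := by field_simp
  have hcont : Tendsto (fun r : ℝ => (n + 2) * (n + 1) * ‖b (n + 2)‖ * r ^ n) (𝓝[<] R)
      (𝓝 ((n + 2) * (n + 1) * ‖b (n + 2)‖ * R ^ n)) :=
    ((by fun_prop : Continuous fun r : ℝ =>
      (n + 2) * (n + 1) * ‖b (n + 2)‖ * r ^ n).tendsto R).mono_left nhdsWithin_le_nhds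
  refine le_of_tendsto hcont ?_
  filter_upwards [Ioo_mem_nhdsLT hR] with r hr' using hr r hr'.1 hr'.2

/-- The second derivative of `g` is bounded on the part of the disc `|z| < R` near `ζ`. -/
def DerivDerivBoundedNear (g : ℂ → ℂ) (R : ℝ) (ζ : ℂ) : Prop :=
  ∃ K, ∀ᶠ z in 𝓝 ζ, ‖z‖ < R → ‖deriv (deriv g) z‖ ≤ K

theorem exists_deriv_deriv_bound {g : ℂ → ℂ} {R : ℝ}
    (h : ∀ ζ : ℂ, ‖ζ‖ ≤ R → DerivDerivBoundedNear g R ζ) :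
    ∃ K, ∀ z : ℂ, ‖z‖ < R → ‖deriv (deriv g) z‖ ≤ K := by
  have hc : ∃ K, ∀ z ∈ Metric.closedBall (0 : ℂ) R, ‖z‖ < R → ‖deriv (deriv g) z‖ ≤ K := by
    refine (isCompact_closedBall (0 : ℂ) R).induction_on
      (p := fun s => ∃ K, ∀ z ∈ s, ‖z‖ < R → ‖deriv (deriv g) z‖ ≤ K) ⟨0, by simp⟩ ?_ ?_ ?_
    · rintro s t hst ⟨K, hK⟩
      exact ⟨K, fun z hz => hK z (hst hz)⟩
    · rintro s t ⟨K, hK⟩ ⟨L, hL⟩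
      refine ⟨max K L, ?_⟩
      rintro z (hz | hz) hzR
      exacts [(hK z hz hzR).trans (le_max_left _ _), (hL z hz hzR).trans (le_max_right _ _)]
    · intro ζ hζ
      obtain ⟨K, hK⟩ := h ζ (by simpa using hζ)
      exact ⟨_, mem_nhdsWithin_of_mem_nhds hK, K, fun z hz => hz⟩
  obtain ⟨K, hK⟩ := hc
  exact ⟨K, fun z hz => hK z (by simpa using hz.le) hz⟩

theorem eventually_nhds_of_lt {g G : ℂ → ℂ} {R : ℝ} {ζ : ℂ}
    (h : ∀ᶠ z in 𝓝 ζ, ‖z‖ < R → g z = G z) :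
    ∀ᶠ z in 𝓝 ζ, ‖z‖ < R → g =ᶠ[𝓝 z] G := by
  filter_upwards [eventually_eventually_nhds.2 h] with z hz hzR
  filter_upwards [hz, (isOpen_lt continuous_norm continuous_const).mem_nhds hzR] with y hy hyR
  exact hy hyR

theorem DerivDerivBoundedNear.of_analyticAt {g G : ℂ → ℂ} {R : ℝ} {ζ : ℂ} (hG : AnalyticAt ℂ G ζ)
    (h : ∀ᶠ z in 𝓝 ζ, ‖z‖ < R → g z = G z) : DerivDerivBoundedNear g R ζ := by
  refine ⟨‖deriv (deriv G) ζ‖ + 1, ?_⟩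
  have hlt : ∀ᶠ z in 𝓝 ζ, ‖deriv (deriv G) z‖ < ‖deriv (deriv G) ζ‖ + 1 :=
    hG.deriv.deriv.continuousAt.norm.eventually_lt_const (lt_add_one _)
  filter_upwards [eventually_nhds_of_lt h, hlt] with z hz hlt hzR
  rw [(hz hzR).deriv.deriv_eq]
  exact hlt.le

/-- Differentiation of a function of `s = √(1 - z / R)` that vanishes to second order at `s = 0`:
since `ds/dz = -1 / (2 R s)`, the derivative is again an analytic function of `s`. -/
theorem deriv_sqrt_sq_mul {R : ℝ} (hR : 0 < R) {g q : ℂ → ℂ} (hq : AnalyticAt ℂ q 0)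
    (h : ∀ᶠ z in 𝓝 (R : ℂ), ‖z‖ < R → g z =
      ((1 - z / (R : ℂ)) ^ (1 / 2 : ℂ)) ^ 2 * q ((1 - z / (R : ℂ)) ^ (1 / 2 : ℂ))) :
    ∀ᶠ z in 𝓝 (R : ℂ), ‖z‖ < R → deriv g z =
      (fun s => -(1 / (2 * R)) * (2 * q s + s * deriv q s)) ((1 - z / (R : ℂ)) ^ (1 / 2 : ℂ)) := by
  have hR' : (R : ℂ) ≠ 0 := by exact_mod_cast hR.ne'
  filter_upwards [eventually_nhds_of_lt h,
    (tendsto_sqrt_one_sub_div hR).eventually hq.eventually_analyticAt] with z hz hqz hzR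
  have hne : z ≠ R := by
    rintro rfl
    simp [abs_of_pos hR] at hzR
  have hre := one_sub_div_re_pos hR hzR.le hne
  rw [(hz hzR).deriv_eq]
  have hr := (analyticAt_sqrt_one_sub_div hR hzR.le hne).differentiableAt.hasDerivAt
  have hsq := Complex.cpow_half_sq (1 - z / (R : ℂ))
  -- differentiate `s ^ 2 = 1 - z / R`
  have hds : 2 * (1 - z / (R : ℂ)) ^ (1 / 2 : ℂ) *
      deriv (fun z : ℂ => (1 - z / (R : ℂ)) ^ (1 / 2 : ℂ)) z = -(1 / R) := by
    have h1 := hr.pow 2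
    have h2 : HasDerivAt (fun z : ℂ => 1 - z / (R : ℂ)) (-(1 / R)) z :=
      ((hasDerivAt_id z).div_const _).const_sub _
    have h3 : ((fun z : ℂ => (1 - z / (R : ℂ)) ^ (1 / 2 : ℂ)) ^ 2) =
        fun z : ℂ => 1 - z / (R : ℂ) := by
      funext z
      exact Complex.cpow_half_sq _
    rw [h3] at h1
    simpa using h1.unique h2
  have hs0 : (1 - z / (R : ℂ)) ^ (1 / 2 : ℂ) ≠ 0 := by
    intro h0
    rw [h0] at hsq
    rw [← hsq] at hre
    simp at hre
  have hd := (hr.pow 2).mul (hqz.differentiableAt.hasDerivAt.comp z hr)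
  have hd' := hd.deriv
  simp only [Pi.pow_def, Pi.mul_def, Function.comp_def] at hd'
  rw [hd']
  generalize deriv (fun z : ℂ => (1 - z / (R : ℂ)) ^ (1 / 2 : ℂ)) z = d at hds ⊢
  generalize (1 - z / (R : ℂ)) ^ (1 / 2 : ℂ) = s at hds hs0 ⊢
  have hd2 : s * d = -(1 / (2 * R)) := by
    field_simp
    field_simp at hds
    linear_combination hds
  push_cast
  linear_combination (2 * q s + s * deriv q s) * hd2

/-- A function of `s = √(1 - z / R)` that vanishes to fourth order at `s = 0` has a bounded second
derivative with respect to `z`. -/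
theorem DerivDerivBoundedNear.of_sqrt {R : ℝ} (hR : 0 < R) {g q : ℂ → ℂ} (hq : AnalyticAt ℂ q 0)
    (h : ∀ᶠ z in 𝓝 (R : ℂ), ‖z‖ < R → g z =
      ((1 - z / (R : ℂ)) ^ (1 / 2 : ℂ)) ^ 4 * q ((1 - z / (R : ℂ)) ^ (1 / 2 : ℂ))) :
    DerivDerivBoundedNear g R R := by
  have hcontr := tendsto_sqrt_one_sub_div hR
  have h1 := deriv_sqrt_sq_mul hR (g := g) (q := fun s => s ^ 2 * q s) (by fun_prop)
    (h.mono fun z hz hzR => by rw [hz hzR]; ring)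
  have hq' := hq.deriv
  have h2 := deriv_sqrt_sq_mul hR (g := deriv g)
    (q := fun s => -(1 / (2 * R)) * (4 * q s + s * deriv q s)) (by fun_prop) (by
      filter_upwards [h1, hcontr.eventually hq.eventually_analyticAt] with z hz hqz hzR
      rw [hz hzR]
      generalize (1 - z / (R : ℂ)) ^ (1 / 2 : ℂ) = s at hqz
      have hd : HasDerivAt (fun s => s ^ 2 * q s) (2 * s * q s + s ^ 2 * deriv q s) s := by
        simpa [Pi.mul_def] using! (hasDerivAt_pow 2 s).mul hqz.differentiableAt.hasDerivAt
      simp only [hd.deriv]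
      ring)
  have h3 : AnalyticAt ℂ (fun s => -(1 / (2 * R)) * (4 * q s + s * deriv q s)) 0 := by fun_prop
  have h4 := h3.deriv
  set k : ℂ → ℂ := fun s => -(1 / (2 * R)) * (2 * (-(1 / (2 * R)) * (4 * q s + s * deriv q s)) +
    s * deriv (fun s => -(1 / (2 * R)) * (4 * q s + s * deriv q s)) s) with hk
  have hk0 : AnalyticAt ℂ k 0 := by fun_prop
  refine ⟨‖k 0‖ + 1, ?_⟩
  have hlt : ∀ᶠ s in 𝓝 (0 : ℂ), ‖k s‖ < ‖k 0‖ + 1 :=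
    hk0.continuousAt.norm.eventually_lt_const (lt_add_one _)
  filter_upwards [h2, hcontr.eventually hlt] with z hz hlt hzR
  rw [hz hzR]
  exact hlt.le

/-! ### Catalan numbers -/

theorem catalan_pos (n : ℕ) : 0 < catalan n :=
  Nat.pos_of_mul_pos_left (succ_mul_catalan_eq_centralBinom n ▸ n.centralBinom_pos)

theorem catalan_succ_recurrence (n : ℕ) : (n + 2) * catalan (n + 1) = 2 * (2 * n + 1) * catalan n := by
  have h1 := succ_mul_catalan_eq_centralBinom (n + 1)
  have h2 := succ_mul_catalan_eq_centralBinom n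
  have h3 := Nat.succ_mul_centralBinom_succ n
  rw [← h1, ← h2] at h3
  have : (n + 1) * ((n + 2) * catalan (n + 1)) = (n + 1) * (2 * (2 * n + 1) * catalan n) := by
    linarith
  exact Nat.eq_of_mul_eq_mul_left n.succ_pos this

/-- The central binomial coefficient `(2 m).choose m` is at least `4 ^ m / (2 √m)`, in squared form. -/
theorem sixteen_pow_le_centralBinom_sq (n : ℕ) :
    16 ^ (n + 1) ≤ 4 * (n + 1) * ((n + 1).centralBinom : ℝ) ^ 2 := by
  induction n with
  | zero => norm_num [Nat.centralBinom, Nat.choose]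
  | succ n ih =>
    have h : ((n + 1 : ℕ) + 1 : ℝ) * ((n + 1 + 1).centralBinom : ℝ) =
        2 * (2 * (n + 1 : ℕ) + 1) * ((n + 1).centralBinom : ℝ) := by
      exact_mod_cast Nat.succ_mul_centralBinom_succ (n + 1)
    push_cast at h ⊢
    have h2 : ((n + 1 + 1).centralBinom : ℝ) =
        2 * (2 * (n + 1) + 1) * ((n + 1).centralBinom : ℝ) / (n + 1 + 1) := by
      rw [← h]
      field_simp
    rw [h2, pow_succ]
    generalize ((n + 1).centralBinom : ℝ) = c at *
    have h3 : 4 * ((n : ℝ) + 1 + 1) * (2 * (2 * (n + 1) + 1) * c / (n + 1 + 1)) ^ 2 =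
        16 * ((2 * (n + 1) + 1) ^ 2 / (n + 1 + 1)) * c ^ 2 := by
      field_simp
      ring
    have h4 : 4 * ((n : ℝ) + 1) ≤ (2 * (n + 1) + 1) ^ 2 / (n + 1 + 1) := by
      rw [le_div_iff₀ (by positivity)]
      nlinarith
    rw [h3]
    calc (16 : ℝ) ^ (n + 1) * 16 ≤ 4 * (n + 1) * c ^ 2 * 16 := by gcongr
      _ = 16 * (4 * (n + 1)) * c ^ 2 := by ring
      _ ≤ _ := by gcongr

/-- The numbers `4 ^ n / (n ^ 2 C_n)` tend to `0`; the true order of magnitude is `n ^ (-1/2)`. -/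
theorem tendsto_four_pow_div_catalan :
    Tendsto (fun n : ℕ => (4 : ℝ) ^ (n + 2) / (((n : ℝ) + 2) * (n + 1) * catalan (n + 1)))
      atTop (𝓝 0) := by
  have hlim : Tendsto (fun n : ℕ => 8 / √((n : ℝ) + 1)) atTop (𝓝 0) := by
    refine Tendsto.const_div_atTop ?_ 8
    exact Real.tendsto_sqrt_atTop.comp (tendsto_atTop_add_const_right _ _ tendsto_natCast_atTop_atTop)
  refine squeeze_zero (fun n => by positivity) (fun n => ?_) hlim
  have h1 : ((n : ℝ) + 2) * catalan (n + 1) = (n + 1).centralBinom := by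
    exact_mod_cast succ_mul_catalan_eq_centralBinom (n + 1)
  have h2 : (4 : ℝ) ^ (n + 1) ≤ 2 * √((n : ℝ) + 1) * (n + 1).centralBinom := by
    refine abs_le_of_sq_le_sq' ?_ (by positivity) |>.2
    rw [mul_pow, mul_pow, Real.sq_sqrt (by positivity), ← pow_mul, mul_comm (n + 1) 2, pow_mul]
    have := sixteen_pow_le_centralBinom_sq n
    norm_num at this ⊢
    exact this
  have e : ((n : ℝ) + 2) * (n + 1) * catalan (n + 1) = (n + 1) * (n + 1).centralBinom := by
    rw [← h1]
    ring
  have hc : (0 : ℝ) < (n + 1).centralBinom := by exact_mod_cast (n + 1).centralBinom_pos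
  rw [e, div_le_div_iff₀ (by positivity) (by positivity)]
  have hs : √((n : ℝ) + 1) ^ 2 = n + 1 := Real.sq_sqrt (by positivity)
  calc (4 : ℝ) ^ (n + 2) * √((n : ℝ) + 1)
      ≤ 4 * (2 * √((n : ℝ) + 1) * (n + 1).centralBinom) * √((n : ℝ) + 1) := by
        rw [pow_succ, mul_comm _ (4 : ℝ)]
        gcongr
    _ = 8 * √((n : ℝ) + 1) ^ 2 * (n + 1).centralBinom := by ring
    _ = _ := by rw [hs]; ring

theorem tendsto_catalan_ratio :
    Tendsto (fun n : ℕ => 4 * (catalan n : ℝ) / catalan (n + 1)) atTop (𝓝 1) := by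
  have h1 : Tendsto (fun n : ℕ => 1 + 3 / (2 * (n : ℝ) + 1)) atTop (𝓝 (1 + 0)) := by
    refine tendsto_const_nhds.add (Tendsto.const_div_atTop ?_ 3)
    exact tendsto_atTop_add_const_right _ _
      (tendsto_natCast_atTop_atTop.const_mul_atTop (by norm_num))
  rw [add_zero] at h1
  refine h1.congr fun n => ?_
  have h2 : ((n : ℝ) + 2) * catalan (n + 1) = 2 * (2 * n + 1) * catalan n := by
    exact_mod_cast catalan_succ_recurrence n
  have hc : (0 : ℝ) < catalan (n + 1) := by exact_mod_cast catalan_pos (n + 1)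
  rw [eq_div_iff hc.ne']
  field_simp
  linear_combination 2 * h2

/-! ### Transfer from a square-root singularity to coefficient asymptotics -/

theorem AnalyticAt.exists_eq_add_mul {h : ℂ → ℂ} (hh : AnalyticAt ℂ h 0) :
    ∃ k : ℂ → ℂ, AnalyticAt ℂ k 0 ∧ k 0 = deriv h 0 ∧ ∀ s, h s = h 0 + s * k s := by
  obtain ⟨p, hp⟩ := hh
  refine ⟨dslope h 0, hp.has_fpower_series_dslope_fslope.analyticAt, dslope_same _ _, fun s => ?_⟩
  have := sub_smul_dslope h 0 s
  rw [sub_zero, smul_eq_mul] at this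
  rw [this]
  ring

/-- The coefficients of `(1 - z / R) * f z`, where `f` has the coefficients `b`. -/
noncomputable def mulOneSubCoeff (R : ℝ) (b : ℕ → ℂ) : ℕ → ℂ
  | 0 => b 0
  | n + 1 => b (n + 1) - b n / R

theorem hasSum_mulOneSubCoeff {R : ℝ} {b : ℕ → ℂ} {z f : ℂ}
    (h : HasSum (fun n => b n * z ^ n) f) :
    HasSum (fun n => mulOneSubCoeff R b n * z ^ n) ((1 - z / R) * f) := by
  have h1 : HasSum (fun n => (fun n => match n with
      | 0 => 0
      | n + 1 => b n / R * z ^ (n + 1) : ℕ → ℂ) n) (0 + z / R * f) := by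
    refine HasSum.zero_add ((h.mul_left (z / R)).congr_terms fun n => ?_)
    simp only
    ring
  have h2 := h.sub h1
  rw [zero_add] at h2
  rw [sub_mul, one_mul]
  refine h2.congr_terms fun n => ?_
  rcases n with _ | n
  · simp [mulOneSubCoeff]
  · simp only [mulOneSubCoeff]
    ring

/-- If a power series `∑ aₙ zⁿ` continues analytically to every point of the circle `|z| = R` other
than `R`, and is `h(√(1 - z / R))` near `R` with `deriv h 0 = -c₁`, then `aₙ₊₂` is asymptotic to
`2 c₁ Cₙ₊₁ / (4 R)ⁿ⁺²` with the Catalan number `Cₙ₊₁`. The coefficients of `√(1 - z / R)` are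
Catalan numbers themselves, so that only a remainder with bounded second derivative has to be
estimated. -/
theorem tendsto_coeff_div_catalan {a : ℕ → ℂ} {R : ℝ} {c₁ : ℂ} (hR : 0 < R)
    (hsum : ∀ z : ℂ, ‖z‖ < R → Summable fun n => a n * z ^ n)
    (regular : ∀ ζ : ℂ, ‖ζ‖ = R → ζ ≠ (R : ℂ) → ∃ g : ℂ → ℂ, AnalyticAt ℂ g ζ ∧
      ∀ᶠ z in 𝓝 ζ, ‖z‖ < R → HasSum (fun n => a n * z ^ n) (g z))
    (expansion : ∃ h : ℂ → ℂ, AnalyticAt ℂ h 0 ∧ deriv h 0 = -c₁ ∧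
      ∀ᶠ z in 𝓝 (R : ℂ), ‖z‖ < R →
        HasSum (fun n => a n * z ^ n) (h ((1 - z / (R : ℂ)) ^ (1 / 2 : ℂ)))) :
    Tendsto (fun n => a (n + 2) * (4 * R) ^ (n + 2) / catalan (n + 1)) atTop (𝓝 (2 * c₁)) := by
  have hR' : (R : ℂ) ≠ 0 := by exact_mod_cast hR.ne'
  obtain ⟨h, hh, hc₁, hexp⟩ := expansion
  obtain ⟨h₁, hh₁, h₁0, eh₁⟩ := hh.exists_eq_add_mul
  obtain ⟨h₂, hh₂, -, eh₂⟩ := hh₁.exists_eq_add_mul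
  obtain ⟨h₃, hh₃, -, eh₃⟩ := hh₂.exists_eq_add_mul
  obtain ⟨q, hq, -, eq⟩ := hh₃.exists_eq_add_mul
  rw [hc₁] at h₁0
  -- subtract the expansion at `R` up to the term `(1 - z / R) ^ (3 / 2)`
  set f : ℂ → ℂ := fun z => ∑' n, a n * z ^ n with hf
  set g : ℂ → ℂ := fun z => f z - h 0 - h₂ 0 * (1 - z / R) -
    (-c₁) * (1 - z / (R : ℂ)) ^ (1 / 2 : ℂ) -
    h₃ 0 * ((1 - z / R) * (1 - z / (R : ℂ)) ^ (1 / 2 : ℂ)) with hg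
  set e : ℕ → ℂ := fun n => if n = 0 then 1 else 0 with he
  set b : ℕ → ℂ := fun n => a n - h 0 * e n - h₂ 0 * mulOneSubCoeff R e n -
    (-c₁) * sqrtCoeff R n - h₃ 0 * mulOneSubCoeff R (sqrtCoeff R) n with hb
  have hfsum : ∀ z : ℂ, ‖z‖ < R → HasSum (fun n => a n * z ^ n) (f z) :=
    fun z hz => (hsum z hz).hasSum
  have hesum : ∀ z : ℂ, HasSum (fun n => e n * z ^ n) 1 := fun z => by
    refine HasSum.congr_terms (f := fun n => if n = 0 then (1 : ℂ) else 0) ?_ fun n => ?_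
    · simpa using hasSum_ite_eq (0 : ℕ) (1 : ℂ)
    · rcases n with _ | n <;> simp [he]
  have hgsum : ∀ z : ℂ, ‖z‖ < R → HasSum (fun n => b n * z ^ n) (g z) := by
    intro z hz
    have hr := hasSum_sqrtCoeff hR hz
    have := ((((hfsum z hz).sub ((hesum z).mul_left (h 0))).sub
      ((hasSum_mulOneSubCoeff (R := R) (hesum z)).mul_left (h₂ 0))).sub
      (hr.mul_left (-c₁))).sub ((hasSum_mulOneSubCoeff (R := R) hr).mul_left (h₃ 0))
    rw [mul_one, mul_one] at this
    refine this.congr_terms fun n => ?_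
    simp only [hb]
    ring
  have hbound : ∀ ζ : ℂ, ‖ζ‖ ≤ R → DerivDerivBoundedNear g R ζ := by
    intro ζ hζ
    by_cases hne : ζ = R
    · subst hne
      refine DerivDerivBoundedNear.of_sqrt hR hq ?_
      filter_upwards [hexp] with z hz hzR
      have hsq := Complex.cpow_half_sq (1 - z / (R : ℂ))
      simp only [hg]
      rw [(hfsum z hzR).unique (hz hzR)]
      generalize (1 - z / (R : ℂ)) ^ (1 / 2 : ℂ) = s at *
      rw [← hsq, eh₁ s, eh₂ s, eh₃ s, eq s, h₁0]
      ring
    · have hr := analyticAt_sqrt_one_sub_div hR hζ hne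
      obtain ⟨G, hG, hGe⟩ : ∃ G : ℂ → ℂ, AnalyticAt ℂ G ζ ∧ ∀ᶠ z in 𝓝 ζ, ‖z‖ < R → f z = G z := by
        rcases hζ.lt_or_eq with hlt | heq
        · exact ⟨f, analyticAt_of_hasSum hR hfsum hlt, Eventually.of_forall fun _ _ => rfl⟩
        · obtain ⟨G, hG, hGe⟩ := regular ζ heq hne
          exact ⟨G, hG, hGe.mono fun z hz hzR => (hfsum z hzR).unique (hz hzR)⟩
      refine DerivDerivBoundedNear.of_analyticAt (G := fun z => G z - h 0 - h₂ 0 * (1 - z / R) -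
        (-c₁) * (1 - z / (R : ℂ)) ^ (1 / 2 : ℂ) -
        h₃ 0 * ((1 - z / R) * (1 - z / (R : ℂ)) ^ (1 / 2 : ℂ))) ?_ ?_
      · have hl : AnalyticAt ℂ (fun z : ℂ => 1 - z / (R : ℂ)) ζ := by fun_prop
        exact (((hG.sub analyticAt_const).sub (analyticAt_const.mul hl)).sub
          (analyticAt_const.mul hr)).sub (analyticAt_const.mul (hl.mul hr))
      · filter_upwards [hGe] with z hz hzR
        simp only [hg]
        rw [hz hzR]
  obtain ⟨K, hK⟩ := exists_deriv_deriv_bound hbound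
  have hcoeff := norm_coeff_le_of_deriv_deriv_le hR hgsum hK
  have hcat : ∀ n, (catalan n : ℂ) ≠ 0 := fun n => by exact_mod_cast (catalan_pos n).ne'
  have hform : ∀ n, a (n + 2) * (4 * R) ^ (n + 2) / catalan (n + 1) =
      2 * c₁ - 2 * h₃ 0 * (1 - ((4 * (catalan n : ℝ) / catalan (n + 1) : ℝ) : ℂ)) +
        b (n + 2) * (4 * R) ^ (n + 2) / catalan (n + 1) := by
    intro n
    have hm : mulOneSubCoeff R e (n + 2) = 0 := by simp [mulOneSubCoeff, he]
    have : a (n + 2) = b (n + 2) + (-c₁) * sqrtCoeff R (n + 2) +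
        h₃ 0 * (sqrtCoeff R (n + 2) - sqrtCoeff R (n + 1) / R) := by
      have he2 : e (n + 2) = 0 := by simp [he]
      have hm2 : mulOneSubCoeff R (sqrtCoeff R) (n + 2) =
        sqrtCoeff R (n + 2) - sqrtCoeff R (n + 1) / R := rfl
      simp only [hb, hm, he2, hm2]
      ring
    rw [this, sqrtCoeff_succ, sqrtCoeff_succ]
    have := hcat (n + 1)
    push_cast
    field_simp
    ring
  have hsmall : Tendsto (fun n => b (n + 2) * (4 * R) ^ (n + 2) / catalan (n + 1)) atTop (𝓝 0) := by
    have h0 := tendsto_four_pow_div_catalan.const_mul (K * R ^ 2)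
    rw [mul_zero] at h0
    refine squeeze_zero_norm (fun n => ?_) h0
    have hc : (0 : ℝ) < catalan (n + 1) := by exact_mod_cast catalan_pos (n + 1)
    rw [norm_div, norm_mul, norm_pow, norm_mul, Complex.norm_natCast, Complex.norm_real,
      Complex.norm_ofNat, Real.norm_of_nonneg hR.le, ← mul_div_assoc,
      div_le_div_iff₀ hc (by positivity)]
    calc ‖b (n + 2)‖ * (4 * R) ^ (n + 2) * ((n + 2) * (n + 1) * catalan (n + 1))
        = ((n + 2) * (n + 1) * ‖b (n + 2)‖ * R ^ n) *
            (R ^ 2 * 4 ^ (n + 2) * catalan (n + 1)) := by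
          rw [mul_pow]
          ring
      _ ≤ K * (R ^ 2 * 4 ^ (n + 2) * catalan (n + 1)) := by
          gcongr
          exact hcoeff n
      _ = _ := by ring
  have hratio : Tendsto (fun n : ℕ => ((4 * (catalan n : ℝ) / catalan (n + 1) : ℝ) : ℂ)) atTop
      (𝓝 ((1 : ℝ) : ℂ)) :=
    (Complex.continuous_ofReal.tendsto _).comp tendsto_catalan_ratio
  have hlim := ((tendsto_const_nhds (x := 2 * c₁)).sub
    ((tendsto_const_nhds (x := 1)).sub hratio |>.const_mul (2 * h₃ 0))).add hsmall
  simp only [Complex.ofReal_one, sub_self, mul_zero, sub_zero, add_zero] at hlim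
  exact hlim.congr fun n => (hform n).symm

/-- The radius of convergence, from the quotients of successive coefficients. -/
theorem radius_eq_of_tendsto_coeff_div_catalan {a : ℕ → ℂ} {R : ℝ} {c : ℂ} (hR : 0 < R)
    (hc : c ≠ 0)
    (h : Tendsto (fun n => a (n + 2) * (4 * R) ^ (n + 2) / catalan (n + 1)) atTop (𝓝 c)) :
    (FormalMultilinearSeries.ofScalars ℂ a).radius = ENNReal.ofReal R := by
  have hR' : (R : ℂ) ≠ 0 := by exact_mod_cast hR.ne'
  have hcat : ∀ n, (catalan n : ℂ) ≠ 0 := fun n => by exact_mod_cast (catalan_pos n).ne'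
  have hr0 : R.toNNReal ≠ 0 := by simpa using hR
  refine FormalMultilinearSeries.ofScalars_radius_eq_of_tendsto ℂ a hr0 ?_
  rw [Real.coe_toNNReal R hR.le, ← tendsto_add_atTop_iff_nat 2]
  have h1 := h.div (h.comp (tendsto_add_atTop_nat 1)) hc
  have h2 : Tendsto (fun n : ℕ => ((4 * (catalan n : ℝ) / catalan (n + 1) : ℝ) : ℂ)) atTop
      (𝓝 ((1 : ℝ) : ℂ)) :=
    (Complex.continuous_ofReal.tendsto _).comp tendsto_catalan_ratio
  have h3 := ((h1.mul (h2.comp (tendsto_add_atTop_nat 1))).mul_const (R : ℂ)).norm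
  rw [div_self hc, Complex.ofReal_one, one_mul, one_mul, Complex.norm_real,
    Real.norm_of_nonneg hR.le] at h3
  refine h3.congr fun n => ?_
  rw [← norm_div]
  congr 1
  simp only [Pi.div_apply, Function.comp_apply]
  have e1 := hcat (n + 1)
  have e2 := hcat (n + 2)
  push_cast
  rw [Nat.succ_eq_add_one, show n + 2 + 1 = n + 1 + 2 by ring, show n + 1 + 1 = n + 2 by ring]
  by_cases ha : a (n + 1 + 2) = 0
  · simp [ha]
  · field_simp
    ring

/-! ### Analytic implicit functions of one variable -/

/-- The analytic implicit function theorem for `Φ x y = 0`, including local uniqueness of the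
solution. -/
theorem exists_analyticAt_implicit {Φ : ℂ → ℂ → ℂ} {x₀ y₀ : ℂ}
    (hΦ : AnalyticAt ℂ (fun p : ℂ × ℂ => Φ p.1 p.2) (x₀, y₀)) (h₀ : Φ x₀ y₀ = 0)
    (hy : deriv (Φ x₀) y₀ ≠ 0) :
    ∃ ψ : ℂ → ℂ, AnalyticAt ℂ ψ x₀ ∧ ψ x₀ = y₀ ∧ (∀ᶠ x in 𝓝 x₀, Φ x (ψ x) = 0) ∧
      ∀ᶠ p in 𝓝 (x₀, y₀), Φ p.1 p.2 = 0 → p.2 = ψ p.1 := by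
  -- `ψ x` is the second component of the local inverse of `(x, y) ↦ (x, Φ x y)` at `(x, 0)`
  set P : ℂ × ℂ → ℂ × ℂ := fun p => (p.1, Φ p.1 p.2) with hP
  have hPan : AnalyticAt ℂ P (x₀, y₀) := analyticAt_fst.prod hΦ
  obtain ⟨p, hp⟩ := hPan
  have hd := hp.hasStrictFDerivAt
  set L := continuousMultilinearCurryFin1 ℂ (ℂ × ℂ) (ℂ × ℂ) (p 1) with hL
  have hfst : ∀ v, (L v).1 = v.1 := by
    intro v
    have h1 := (hasFDerivAt_fst (𝕜 := ℂ) (p := P (x₀, y₀))).comp _ hd.hasFDerivAt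
    have h2 := h1.unique (hasFDerivAt_fst (𝕜 := ℂ) (p := (x₀, y₀)))
    exact congrArg (fun l : ℂ × ℂ →L[ℂ] ℂ => l v) h2
  have hsnd : ∀ w, (L (0, w)).2 = w * deriv (Φ x₀) y₀ := by
    intro w
    have h1 := (hasFDerivAt_snd (𝕜 := ℂ) (p := P (x₀, y₀))).comp _ hd.hasFDerivAt
    have h2 : HasDerivAt (fun y : ℂ => (x₀, y)) ((0 : ℂ), (1 : ℂ)) y₀ :=
      (hasDerivAt_const y₀ x₀).prodMk (hasDerivAt_id y₀)
    have h3 := h1.comp_hasDerivAt y₀ h2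
    have h4 : deriv (Φ x₀) y₀ = (L (0, 1)).2 := h3.deriv
    have h5 : ((0 : ℂ), w) = w • ((0 : ℂ), (1 : ℂ)) := by simp
    rw [h4, h5, map_smul]
    simp
  have hinj : LinearMap.ker (L : ℂ × ℂ →ₗ[ℂ] ℂ × ℂ) = ⊥ := by
    rw [LinearMap.ker_eq_bot']
    rintro ⟨v, w⟩ hvw
    have hvw' : L (v, w) = 0 := hvw
    have hv := hfst (v, w)
    rw [hvw'] at hv
    have hv' : v = 0 := hv.symm
    subst hv'
    have hw := hsnd w
    rw [hvw'] at hw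
    have hw' : w = 0 := by simpa [hy] using hw.symm
    rw [hw']
    rfl
  have hsurj : LinearMap.range (L : ℂ × ℂ →ₗ[ℂ] ℂ × ℂ) = ⊤ :=
    LinearMap.ker_eq_bot_iff_range_eq_top.1 hinj
  set i : (ℂ × ℂ) ≃L[ℂ] ℂ × ℂ := ContinuousLinearEquiv.ofBijective L hinj hsurj with hi
  have hiL : (i : ℂ × ℂ →L[ℂ] ℂ × ℂ) = L := ContinuousLinearEquiv.coe_ofBijective L hinj hsurj
  have hdi : HasStrictFDerivAt P (i : ℂ × ℂ →L[ℂ] ℂ × ℂ) (x₀, y₀) := by rwa [hiL]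
  let Q := hdi.toOpenPartialHomeomorph P
  have hmem : (x₀, y₀) ∈ Q.source := hdi.mem_toOpenPartialHomeomorph_source
  have hP₀ : P (x₀, y₀) = (x₀, 0) := by rw [hP]; simp [h₀]
  have hQ : (Q : ℂ × ℂ → ℂ × ℂ) = P := rfl
  have hsymm : AnalyticAt ℂ Q.symm (x₀, 0) := by
    rw [← hP₀]
    refine (Q.hasFPowerSeriesAt_symm hmem hp (i := i) ?_).analyticAt
    rw [hiL, hL]
    simp
  have hQ₀ : Q.symm (x₀, 0) = (x₀, y₀) := by
    rw [← hP₀]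
    exact Q.left_inv hmem
  have hpair : Tendsto (fun x : ℂ => (x, (0 : ℂ))) (𝓝 x₀) (𝓝 (x₀, 0)) :=
    (by fun_prop : Continuous fun x : ℂ => (x, (0 : ℂ))).tendsto x₀
  refine ⟨fun x => (Q.symm (x, 0)).2, ?_, ?_, ?_, ?_⟩
  · have h1 : AnalyticAt ℂ (fun x : ℂ => (x, (0 : ℂ))) x₀ := by fun_prop
    exact analyticAt_snd.comp (hsymm.fun_comp_of_eq h1 rfl)
  · exact congrArg Prod.snd hQ₀
  · have h1 : ∀ᶠ q in 𝓝 (x₀, (0 : ℂ)), P (Q.symm q) = q := by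
      have := Q.eventually_right_inverse' hmem
      rwa [hQ, hP₀] at this
    filter_upwards [hpair.eventually h1] with x hx
    have h2 := congrArg Prod.fst hx
    have h3 := congrArg Prod.snd hx
    simp only [hP] at h2 h3
    rwa [h2] at h3
  · filter_upwards [Q.eventually_left_inverse hmem] with q hq hq0
    have h1 : P q = (q.1, 0) := by simp only [hP, hq0]
    rw [hQ, h1] at hq
    rw [hq]

/-! ### The algebraic curve -/

namespace OrderedTree

/-- The value at `z₀` of the parameter `t`. -/
noncomputable def critT : ℝ := (7 - 3 * √5) / 2

/-- The value at `z₀` of the parameter `α`. -/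
noncomputable def critA : ℝ := (3 - √5) / 2

/-- The parameter `t = D / (1 - C)`, where `C` and `D` are the generating functions of all matchings
and of those avoiding the root. -/
noncomputable def paramT (z : ℂ) : ℂ := gf rootFreeMatchings z / (1 - gf matchings z)

/-- The parameter `α = A / (1 - C)`, where `A` is the generating function of `Z(T) r(T)` and `C`
that of `Z(T)`. -/
noncomputable def paramA (z : ℂ) : ℂ := gf matchingsRoot z / (1 - gf matchings z)

/-- The relation `zCurve z t = 0` expresses `z` by `t`. -/
def zCurve (z t : ℂ) : ℂ := z * (1 + t + t ^ 2) ^ 2 - t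

/-- The relation `aCurve t a = 0` defines the algebraic function `α` of `t`. -/
def aCurve (t a : ℂ) : ℂ := (a - t - a ^ 2) * (1 - a) ^ 2 - t ^ 2 * (1 - a) - t ^ 2

/-- The generating function of `Z(T) ρ(T)` as a rational function of `t` and `α`. -/
noncomputable def ratE (t a : ℂ) : ℂ :=
  (t + a ^ 2 + (t / (1 - a)) ^ 2 + 2 * t * (t + a * (t / (1 - a)))) /
    ((1 + t + t ^ 2) * (1 - t - 3 * t ^ 2))

theorem critT_pos : 0 < critT := by
  have := sqrt_five_lt
  unfold critT
  linarith

theorem critT_sq : critT ^ 2 = 7 * critT - 1 := by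
  have := sqrt_five_sq
  unfold critT
  linear_combination 9 / 4 * this

theorem critA_nonneg : 0 ≤ critA := by
  have := sqrt_five_lt
  unfold critA
  linarith

theorem critA_lt : critA < 0.4 := by
  have := sqrt_five_gt
  unfold critA
  linarith

theorem one_sub_ne_zero_of_norm_le {a : ℂ} (ha : ‖a‖ ≤ critA) : 1 - a ≠ 0 := by
  intro h
  have h1 : a = 1 := by linear_combination -h
  rw [h1, norm_one] at ha
  have := critA_lt
  linarith

theorem le_norm_one_sub {a : ℂ} (ha : ‖a‖ ≤ critA) : 1 - critA ≤ ‖1 - a‖ := by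
  have := norm_sub_norm_le (1 : ℂ) a
  rw [norm_one] at this
  linarith

theorem denom_ne_zero {t : ℂ} (ht : ‖t‖ ≤ critT) : 1 - t - 3 * t ^ 2 ≠ 0 := by
  intro h
  have h1 : (1 : ℂ) = t + 3 * t ^ 2 := by linear_combination h
  have h2 : (1 : ℝ) ≤ ‖t‖ + 3 * ‖t‖ ^ 2 := by
    calc (1 : ℝ) = ‖t + 3 * t ^ 2‖ := by rw [← h1, norm_one]
      _ ≤ ‖t‖ + ‖3 * t ^ 2‖ := norm_add_le _ _
      _ = _ := by simp
  have h3 : critT < 0.2 := by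
    have := sqrt_five_gt
    unfold critT
    linarith
  nlinarith [norm_nonneg t]

theorem norm_one_sub_gf_ge {z : ℂ} (hz : ‖z‖ ≤ critZ) :
    (7 + 3 * √5) / 16 ≤ ‖1 - gf matchings z‖ := by
  have h := boundedAt_critZ_all.1.norm_gf_le hz
  have := norm_sub_norm_le (1 : ℂ) (gf matchings z)
  rw [norm_one] at this
  linarith

theorem one_sub_gf_ne_zero {z : ℂ} (hz : ‖z‖ ≤ critZ) : 1 - gf matchings z ≠ 0 := by
  have h := norm_one_sub_gf_ge hz
  rw [← norm_pos_iff]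
  have : 0 < (7 + 3 * √5) / 16 := by positivity
  linarith

theorem norm_paramT_le {z : ℂ} (hz : ‖z‖ ≤ critZ) : ‖paramT z‖ ≤ critT := by
  have h1 := boundedAt_critZ_all.2.1.norm_gf_le hz
  have h2 := norm_one_sub_gf_ge hz
  have h3 : 0 < (7 + 3 * √5) / 16 := by positivity
  have h4 := critT_pos
  rw [paramT, norm_div, div_le_iff₀ (h3.trans_le h2)]
  refine h1.trans (le_trans ?_ (mul_le_mul_of_nonneg_left h2 h4.le))
  have := sqrt_five_sq
  unfold critT
  linarith

/-- The strict inequality outside `z₀` is what keeps the critical point of the curve away from all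
other points of the circle `|z| = z₀`. -/
theorem norm_paramT_lt {z : ℂ} (hz : ‖z‖ ≤ critZ) (hne : z ≠ critZ) : ‖paramT z‖ < critT := by
  have hedge : rootFreeMatchings (node [node []]) = 1 := by
    rw [rootFreeMatchings_cons, matchings_nil, rootFreeMatchings_nil]
  have h1 := boundedAt_critZ_all.2.1.norm_gf_lt rootFreeMatchings_nil hedge hz hne
  have h2 := norm_one_sub_gf_ge hz
  have h3 : 0 < (7 + 3 * √5) / 16 := by positivity
  have h4 := critT_pos
  rw [paramT, norm_div, div_lt_iff₀ (h3.trans_le h2)]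
  refine h1.trans_le (le_trans ?_ (mul_le_mul_of_nonneg_left h2 h4.le))
  have := sqrt_five_sq
  unfold critT
  linarith

theorem norm_paramA_le {z : ℂ} (hz : ‖z‖ ≤ critZ) : ‖paramA z‖ ≤ critA := by
  have h1 := boundedAt_critZ_all.2.2.1.norm_gf_le hz
  have h2 := norm_one_sub_gf_ge hz
  have h3 : 0 < (7 + 3 * √5) / 16 := by positivity
  have h4 := critA_nonneg
  rw [paramA, norm_div, div_le_iff₀ (h3.trans_le h2)]
  refine h1.trans (le_trans ?_ (mul_le_mul_of_nonneg_left h2 h4))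
  have := sqrt_five_sq
  unfold critA
  linarith

theorem continuousOn_paramT : ContinuousOn paramT (Metric.closedBall 0 critZ) :=
  (boundedAt_critZ_all.2.1.continuousOn critZ_pos.le).div
    (continuousOn_const.sub (boundedAt_critZ_all.1.continuousOn critZ_pos.le))
    fun _ hz => one_sub_gf_ne_zero (by simpa using hz)

theorem continuousOn_paramA : ContinuousOn paramA (Metric.closedBall 0 critZ) :=
  (boundedAt_critZ_all.2.2.1.continuousOn critZ_pos.le).div
    (continuousOn_const.sub (boundedAt_critZ_all.1.continuousOn critZ_pos.le))
    fun _ hz => one_sub_gf_ne_zero (by simpa using hz)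

/-- The polynomial system of the generating functions, after dividing each of them by `u = 1 - C`:
it becomes homogeneous in `u`, so that `u` itself can be eliminated. -/
theorem param_equations {z : ℂ} (hz : ‖z‖ ≤ critZ) :
    1 + paramT z + paramT z ^ 2 ≠ 0 ∧ zCurve z (paramT z) = 0 ∧ aCurve (paramT z) (paramA z) = 0 ∧
      gf matchingsSub z = ratE (paramT z) (paramA z) := by
  obtain ⟨eC, eD, eA, eB, eE, eF⟩ := gf_system hz
  have hu := one_sub_gf_ne_zero hz
  have ha := one_sub_ne_zero_of_norm_le (norm_paramA_le hz)
  have hden := denom_ne_zero (norm_paramT_le hz)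
  have hD : gf rootFreeMatchings z = paramT z * (1 - gf matchings z) := by
    rw [paramT, div_mul_cancel₀ _ hu]
  have hA : gf matchingsRoot z = paramA z * (1 - gf matchings z) := by
    rw [paramA, div_mul_cancel₀ _ hu]
  generalize paramT z = t at *
  generalize paramA z = a at *
  obtain ⟨u, hu'⟩ : ∃ u, u = 1 - gf matchings z := ⟨_, rfl⟩
  have hC : gf matchings z = 1 - u := by rw [hu']; ring
  rw [← hu'] at hu hD hA
  rw [hC, hD] at eC eD
  rw [hC, hD, hA] at eA eE eF
  rw [hC, hA] at eB
  have hz1 : z = t * u ^ 2 := by linear_combination -eD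
  obtain ⟨τ, hτ⟩ : ∃ τ, τ = t / (1 - a) := ⟨_, rfl⟩
  have hτ' : τ * (1 - a) = t := by rw [hτ, div_mul_cancel₀ _ ha]
  have hB : gf rootFreeRoot z = τ * u := by
    have : gf rootFreeRoot z * (u * (1 - a)) = τ * u * (u * (1 - a)) := by
      linear_combination eB + hz1 - u ^ 2 * hτ'
    exact mul_right_cancel₀ (mul_ne_zero hu ha) this
  rw [hB] at eA eE eF
  have h1 : u * (1 + t + t ^ 2) = 1 := by
    refine mul_left_cancel₀ hu ?_
    linear_combination -hz1 - eC
  have h2 : 1 + t + t ^ 2 ≠ 0 := fun h => by simp [h] at h1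
  refine ⟨h2, ?_, ?_, ?_⟩
  · rw [zCurve, hz1]
    linear_combination t * (u * (1 + t + t ^ 2) + 1) * h1
  · have h3 : a = t + a ^ 2 + t * τ + τ ^ 2 := by
      refine mul_left_cancel₀ (pow_ne_zero 2 hu) ?_
      linear_combination eA + hz1
    rw [aCurve]
    linear_combination (1 - a) ^ 2 * h3 + (t * (1 - a) + τ * (1 - a) + t) * hτ'
  · generalize gf matchingsSub z = E at *
    generalize gf rootFreeSub z = F at *
    rw [ratE, ← hτ, eq_div_iff (mul_ne_zero h2 hden)]
    have h3 : u ^ 2 * (E * (1 - t - 3 * t ^ 2)) =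
        u ^ 2 * (u * (t + a ^ 2 + τ ^ 2 + 2 * t * (t + a * τ))) := by
      have h4 : E * (2 * u - 1) = z + (a * u) ^ 2 + (τ * u) ^ 2 + 2 * F * (t * u) := by
        linear_combination eE
      have h5 : F * u = z + E * (t * u) + a * u * (τ * u) := by linear_combination eF
      linear_combination u * h4 + 2 * t * u * h5 + (u + 2 * t * u) * hz1 - u * E * h1
    have h4 := mul_left_cancel₀ (pow_ne_zero 2 hu) h3
    calc E * ((1 + t + t ^ 2) * (1 - t - 3 * t ^ 2))
        = (1 + t + t ^ 2) * (E * (1 - t - 3 * t ^ 2)) := by ring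
      _ = (t + a ^ 2 + τ ^ 2 + 2 * t * (t + a * τ)) * (u * (1 + t + t ^ 2)) := by
        rw [h4]
        ring
      _ = _ := by rw [h1, mul_one]

theorem hasDerivAt_zCurve (z t : ℂ) :
    HasDerivAt (zCurve z) (2 * z * (1 + t + t ^ 2) * (1 + 2 * t) - 1) t := by
  have h1 : HasDerivAt (fun t : ℂ => 1 + t + t ^ 2) (1 + 2 * t) t := by
    simpa using! ((hasDerivAt_id t).const_add 1).add (hasDerivAt_pow 2 t)
  convert! ((h1.pow 2).const_mul z).sub (hasDerivAt_id t) using 1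
  simp
  ring

theorem hasDerivAt_aCurve (t a : ℂ) : HasDerivAt (aCurve t)
    ((1 - 2 * a) * (1 - a) ^ 2 - 2 * (1 - a) * (a - t - a ^ 2) + t ^ 2) a := by
  have h1 : HasDerivAt (fun a : ℂ => 1 - a) (-1) a := by
    simpa using (hasDerivAt_id a).const_sub 1
  have h2 : HasDerivAt (fun a : ℂ => a - t - a ^ 2) (1 - 2 * a) a := by
    simpa using! ((hasDerivAt_id a).sub_const t).sub (hasDerivAt_pow 2 a)
  convert! ((h2.mul (h1.pow 2)).sub (h1.const_mul (t ^ 2))).sub (hasDerivAt_const a (t ^ 2)) using 1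
  simp
  ring

theorem deriv_zCurve_ne_zero {z t : ℂ} (ht : ‖t‖ ≤ critT)
    (h : zCurve z t = 0) : deriv (zCurve z) t ≠ 0 := by
  rw [(hasDerivAt_zCurve z t).deriv]
  intro h0
  rw [zCurve] at h
  refine denom_ne_zero ht ?_
  linear_combination 2 * (1 + 2 * t) * h - (1 + t + t ^ 2) * h0

/-- Away from the critical point the defining relation of `α` can be solved for `α`: it reads
`α = G(α, t)` with a power series `G` with nonnegative coefficients, and the partial derivative
`∂G/∂α` increases to `1` at the critical point. -/
theorem deriv_aCurve_ne_zero {t a : ℂ} (ht : ‖t‖ < critT) (ha : ‖a‖ ≤ critA)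
    (h : aCurve t a = 0) : deriv (aCurve t) a ≠ 0 := by
  rw [(hasDerivAt_aCurve t a).deriv]
  intro h0
  have h1a := one_sub_ne_zero_of_norm_le ha
  obtain ⟨τ, hτ⟩ : ∃ τ, τ = t / (1 - a) := ⟨_, rfl⟩
  have hτ' : t = τ * (1 - a) := by rw [hτ, div_mul_cancel₀ _ h1a]
  have h5 := sqrt_five_sq
  have hc : 1 - critA = (√5 - 1) / 2 := by unfold critA; ring
  have hcpos : 0 < 1 - critA := by
    have := critA_lt
    linarith
  have hge := le_norm_one_sub ha
  have hτn : ‖τ‖ < √5 - 2 := by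
    rw [hτ, norm_div, div_lt_iff₀ (hcpos.trans_le hge)]
    have h6 := sqrt_five_gt
    refine ht.trans_le (le_trans ?_ (mul_le_mul_of_nonneg_left hge (by linarith)))
    rw [hc]
    unfold critT
    linarith
  have key : 1 = 2 * a + τ ^ 2 + 2 * τ ^ 2 / (1 - a) := by
    have h2 : a - t - a ^ 2 = t ^ 2 / (1 - a) + t ^ 2 / (1 - a) ^ 2 := by
      rw [aCurve] at h
      field_simp
      linear_combination h
    rw [h2, hτ'] at h0
    have h3 : (1 - a) ^ 2 * (1 - (2 * a + τ ^ 2 + 2 * τ ^ 2 / (1 - a))) = 0 := by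
      rw [← h0]
      field_simp
      ring
    have h4 := (mul_eq_zero.1 h3).resolve_left (pow_ne_zero 2 h1a)
    linear_combination h4
  have h7 : (1 : ℝ) ≤ 2 * ‖a‖ + ‖τ‖ ^ 2 + 2 * ‖τ‖ ^ 2 / ‖1 - a‖ := by
    calc (1 : ℝ) = ‖2 * a + τ ^ 2 + 2 * τ ^ 2 / (1 - a)‖ := by rw [← key, norm_one]
      _ ≤ ‖2 * a‖ + ‖τ ^ 2‖ + ‖2 * τ ^ 2 / (1 - a)‖ := norm_add₃_le
      _ = _ := by simp
  have h8 : 2 * ‖τ‖ ^ 2 / ‖1 - a‖ ≤ 2 * ‖τ‖ ^ 2 / (1 - critA) := by gcongr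
  have h9 : ‖τ‖ ^ 2 < (√5 - 2) ^ 2 := by gcongr
  have h10 : 2 * ‖τ‖ ^ 2 / (1 - critA) = ‖τ‖ ^ 2 * (√5 + 1) := by
    rw [hc]
    have : √5 - 1 ≠ 0 := by
      have := sqrt_five_gt
      linarith
    field_simp
    linear_combination (-‖τ‖ ^ 2) * h5
  have h11 : ‖τ‖ ^ 2 * (√5 + 2) < (√5 - 2) ^ 2 * (√5 + 2) := by gcongr
  have h12 : critA = (3 - √5) / 2 := rfl
  nlinarith

theorem analyticAt_ratE {f g : ℂ → ℂ} {x : ℂ} (hf : AnalyticAt ℂ f x) (hg : AnalyticAt ℂ g x)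
    (h₁ : 1 + f x + f x ^ 2 ≠ 0) (h₂ : 1 - f x - 3 * f x ^ 2 ≠ 0) (h₃ : 1 - g x ≠ 0) :
    AnalyticAt ℂ (fun y => ratE (f y) (g y)) x := by
  unfold ratE
  have hq : AnalyticAt ℂ (fun y => f y / (1 - g y)) x := hf.div (analyticAt_const.sub hg) h₃
  refine AnalyticAt.div ?_ ?_ (mul_ne_zero h₁ h₂)
  · exact ((hf.add (hg.pow 2)).add (hq.pow 2)).add
      ((analyticAt_const.mul hf).mul (hf.add (hg.mul hq)))
  · exact ((analyticAt_const.add hf).add (hf.pow 2)).mul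
      ((analyticAt_const.sub hf).sub (analyticAt_const.mul (hf.pow 2)))

theorem analyticAt_zCurve (p : ℂ × ℂ) : AnalyticAt ℂ (fun p : ℂ × ℂ => zCurve p.1 p.2) p := by
  have h1 : AnalyticAt ℂ (fun p : ℂ × ℂ => p.1) p := analyticAt_fst
  have h2 : AnalyticAt ℂ (fun p : ℂ × ℂ => p.2) p := analyticAt_snd
  unfold zCurve
  fun_prop

theorem analyticAt_aCurve {E : Type*} [NormedAddCommGroup E] [NormedSpace ℂ E] {f g : E → ℂ} {x : E}
    (hf : AnalyticAt ℂ f x) (hg : AnalyticAt ℂ g x) :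
    AnalyticAt ℂ (fun p => aCurve (f p) (g p)) x := by
  unfold aCurve
  fun_prop

theorem hasSum_coeffZR {z : ℂ} (hz : ‖z‖ ≤ critZ) :
    HasSum (fun n => coeffZR n * z ^ n) (gf matchingsSub z) :=
  boundedAt_critZ_all.2.2.2.2.1.hasSum_coeff hz

/-- A property that holds near `(x, y)` holds for `(f z, g z)` if `z` in the closed disc is near
`ζ`. -/
theorem eventually_param {ζ x y : ℂ} {p : ℂ × ℂ → Prop} {f g : ℂ → ℂ}
    (hf : Tendsto f (𝓝[Metric.closedBall 0 critZ] ζ) (𝓝 x))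
    (hg : Tendsto g (𝓝[Metric.closedBall 0 critZ] ζ) (𝓝 y)) (h : ∀ᶠ q in 𝓝 (x, y), p q) :
    ∀ᶠ z in 𝓝 ζ, ‖z‖ ≤ critZ → p (f z, g z) := by
  have h1 := (hf.prodMk_nhds hg).eventually h
  rw [eventually_nhdsWithin_iff] at h1
  filter_upwards [h1] with z hz hzR using hz (by simpa using hzR)

/-- On the circle `|z| = z₀` outside `z₀`, the implicit function theorem expresses `t` and then `α`
analytically by `z`. -/
theorem regular_coeffZR {ζ : ℂ} (hζ : ‖ζ‖ = critZ) (hne : ζ ≠ (critZ : ℂ)) :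
    ∃ g : ℂ → ℂ, AnalyticAt ℂ g ζ ∧
      ∀ᶠ z in 𝓝 ζ, ‖z‖ < critZ → HasSum (fun n => coeffZR n * z ^ n) (g z) := by
  obtain ⟨h₁, hz, ha, -⟩ := param_equations hζ.le
  obtain ⟨ψ, hψ, hψ₀, -, hψu⟩ := exists_analyticAt_implicit (analyticAt_zCurve _) hz
    (deriv_zCurve_ne_zero (norm_paramT_le hζ.le) hz)
  have haan : AnalyticAt ℂ (fun p : ℂ × ℂ => aCurve (ψ p.1) p.2) (ζ, paramA ζ) := by
    have h2 : AnalyticAt ℂ (fun p : ℂ × ℂ => ψ p.1) (ζ, paramA ζ) :=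
      hψ.fun_comp_of_eq analyticAt_fst rfl
    have h3 : AnalyticAt ℂ (fun p : ℂ × ℂ => p.2) (ζ, paramA ζ) := analyticAt_snd
    exact analyticAt_aCurve h2 h3
  obtain ⟨χ, hχ, hχ₀, -, hχu⟩ := exists_analyticAt_implicit (Φ := fun z a => aCurve (ψ z) a) haan
    (by simpa only [hψ₀] using ha) (by
      rw [hψ₀]
      exact deriv_aCurve_ne_zero (norm_paramT_lt hζ.le hne) (norm_paramA_le hζ.le) ha)
  refine ⟨fun z => ratE (ψ z) (χ z), analyticAt_ratE hψ hχ ?_ ?_ ?_, ?_⟩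
  · rwa [hψ₀]
  · rw [hψ₀]
    exact denom_ne_zero (norm_paramT_le hζ.le)
  · rw [hχ₀]
    exact one_sub_ne_zero_of_norm_le (norm_paramA_le hζ.le)
  · have hmem : ζ ∈ Metric.closedBall (0 : ℂ) critZ := by simpa using hζ.le
    have hid : Tendsto (fun z : ℂ => z) (𝓝[Metric.closedBall 0 critZ] ζ) (𝓝 ζ) :=
      nhdsWithin_le_nhds
    filter_upwards [eventually_param hid (continuousOn_paramT ζ hmem) hψu,
      eventually_param hid (continuousOn_paramA ζ hmem) hχu] with z h2 h3 hzR
    obtain ⟨-, hz', ha', hE⟩ := param_equations hzR.le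
    have h4 : paramT z = ψ z := h2 hzR.le hz'
    have h5 : paramA z = χ z := h3 hzR.le (by rwa [← h4])
    rw [← h4, ← h5, ← hE]
    exact hasSum_coeffZR hzR.le

end OrderedTree

/-! ### The square-root expansion at the dominant singularity -/

namespace OrderedTree

/-- The values at the critical point as complex numbers. -/
theorem crit_cast : (critT : ℂ) = (7 - 3 * (√5 : ℝ)) / 2 ∧ (critA : ℂ) = (3 - (√5 : ℝ)) / 2 ∧
    ((√5 : ℝ) : ℂ) ^ 2 = 5 := by
  refine ⟨by simp [critT], by simp [critA], ?_⟩
  exact_mod_cast sqrt_five_sq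

/-- The cofactor of `(a - α₀) ^ 2` in the expansion of `aCurve t₀ a`. -/
noncomputable def cofA (a : ℂ) : ℂ := (1 - a) ^ 2 + ((√5 : ℝ) - 2) * (1 - a) + ((√5 : ℝ) - 2) ^ 2

/-- The cofactor of `t₀ - t` in `aCurve t a - aCurve t₀ a`. -/
noncomputable def cofT (t a : ℂ) : ℂ := (1 - a) ^ 2 + (t + critT) * (2 - a)

/-- The cofactor of `t₀ - t` in the numerator of `1 - z / z₀` as a function of `t`. -/
noncomputable def cofZ (t : ℂ) : ℂ :=
  (7 - critT) - (2 + 9 * critT) * t - (2 + critT) * t ^ 2 - t ^ 3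

theorem aCurve_eq (t a : ℂ) : aCurve t a = (critT - t) * cofT t a - (a - critA) ^ 2 * cofA a := by
  obtain ⟨h1, h2, h3⟩ := crit_cast
  rw [aCurve, cofT, cofA, h1, h2]
  generalize ((√5 : ℝ) : ℂ) = s at h3 ⊢
  linear_combination (1 / 4 * ((1 - a) ^ 2 + (7 - 3 * s) * (1 - a) + (3 - s) ^ 2)) * h3

theorem critT_critZ : 64 * (critT : ℂ) * critZ = 1 := by
  have : 64 * critT * critZ = 1 := by
    unfold critT critZ
    linear_combination -9 / 4 * sqrt_five_sq
  exact_mod_cast this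

theorem critT_sq_cast : (critT : ℂ) ^ 2 = 7 * critT - 1 := by exact_mod_cast critT_sq

theorem one_sub_div_critZ {z t : ℂ} (h : zCurve z t = 0) :
    (1 - z / critZ) * (1 + t + t ^ 2) ^ 2 = (critT - t) * cofZ t := by
  have hz : (critZ : ℂ) ≠ 0 := by exact_mod_cast critZ_pos.ne'
  have h1 : z / critZ = 64 * critT * z := by
    field_simp
    linear_combination -z * critT_critZ
  rw [zCurve] at h
  rw [h1, cofZ]
  linear_combination -64 * critT * h + (1 + 9 * t + t ^ 2) * critT_sq_cast

theorem cofZ_ne_zero {t : ℂ} (ht : ‖t‖ ≤ critT) : cofZ t ≠ 0 := by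
  intro h
  rw [cofZ] at h
  have h0 := critT_pos
  have h1 : ((7 - critT : ℝ) : ℂ) = (2 + 9 * critT : ℝ) * t + (2 + critT : ℝ) * t ^ 2 + t ^ 3 := by
    push_cast
    linear_combination h
  have h2 : 7 - critT ≤ (2 + 9 * critT) * ‖t‖ + (2 + critT) * ‖t‖ ^ 2 + ‖t‖ ^ 3 := by
    calc 7 - critT ≤ ‖((7 - critT : ℝ) : ℂ)‖ := by
          rw [Complex.norm_real]
          exact le_abs_self _
      _ ≤ _ := by
          rw [h1]
          refine norm_add₃_le.trans (le_of_eq ?_)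
          rw [norm_mul, norm_mul, norm_pow, norm_pow, Complex.norm_real, Complex.norm_real,
            Real.norm_of_nonneg (by positivity), Real.norm_of_nonneg (by positivity)]
  have h3 : critT < 0.2 := by
    have := sqrt_five_gt
    unfold critT
    linarith
  have h4 : ‖t‖ ≤ 0.2 := ht.trans h3.le
  have h5 : (2 + 9 * critT) * ‖t‖ ≤ (2 + 9 * 0.2) * 0.2 := by gcongr
  have h6 : (2 + critT) * ‖t‖ ^ 2 ≤ (2 + 0.2) * 0.2 ^ 2 := by gcongr
  have h7 : ‖t‖ ^ 3 ≤ 0.2 ^ 3 := by gcongr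
  norm_num at *
  linarith

theorem cofA_ne_zero {a : ℂ} (ha : ‖a‖ ≤ critA) : cofA a ≠ 0 := by
  intro h
  rw [cofA] at h
  have h1 : (1 - a) ^ 2 = -(((√5 - 2 : ℝ) : ℂ) * (1 - a) + ((√5 - 2 : ℝ) : ℂ) ^ 2) := by
    push_cast
    linear_combination h
  have h5 := sqrt_five_gt
  have h5' := sqrt_five_sq
  have h2 : ‖1 - a‖ ^ 2 ≤ (√5 - 2) * ‖1 - a‖ + (√5 - 2) ^ 2 := by
    rw [← norm_pow, h1, norm_neg]
    refine (norm_add_le _ _).trans (le_of_eq ?_)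
    rw [norm_mul, norm_pow, Complex.norm_real, Real.norm_of_nonneg (by linarith)]
  have h3 := le_norm_one_sub ha
  have h4 : 1 - critA = (√5 - 1) / 2 := by unfold critA; ring
  rw [h4] at h3
  nlinarith

theorem paramT_critZ : paramT critZ = critT := by
  have hz : ‖(critZ : ℂ)‖ ≤ critZ := by simp [abs_of_pos critZ_pos]
  obtain ⟨-, h, -, -⟩ := param_equations hz
  have h1 := one_sub_div_critZ h
  rw [div_self (by exact_mod_cast critZ_pos.ne'), sub_self, zero_mul] at h1
  have h2 := (mul_eq_zero.1 h1.symm).resolve_right (cofZ_ne_zero (norm_paramT_le hz))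
  exact (sub_eq_zero.1 h2).symm

theorem paramA_critZ : paramA critZ = critA := by
  have hz : ‖(critZ : ℂ)‖ ≤ critZ := by simp [abs_of_pos critZ_pos]
  obtain ⟨-, -, h, -⟩ := param_equations hz
  rw [paramT_critZ, aCurve_eq, sub_self, zero_mul, zero_sub, neg_eq_zero] at h
  have h2 := (mul_eq_zero.1 h).resolve_right (cofA_ne_zero (norm_paramA_le hz))
  exact sub_eq_zero.1 (pow_eq_zero_iff two_ne_zero |>.1 h2)

theorem cofT_crit : cofT critT critA = (3 * (√5 : ℝ) - 5) / 2 := by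
  obtain ⟨h1, h2, h3⟩ := crit_cast
  rw [cofT, h1, h2]
  generalize ((√5 : ℝ) : ℂ) = s at h3 ⊢
  grind

theorem cofT_crit_ne_zero : cofT critT critA ≠ 0 := by
  rw [cofT_crit]
  have h : (0 : ℝ) < (3 * √5 - 5) / 2 := by
    have := sqrt_five_gt
    linarith
  exact_mod_cast h.ne'

/-- On the curve, `1 - z / z₀ = (α₀ - α) ^ 2 * kappa t α`. -/
noncomputable def kappa (t a : ℂ) : ℂ := cofA a * cofZ t / (cofT t a * (1 + t + t ^ 2) ^ 2)

theorem one_sub_div_critZ_eq {z t a : ℂ} (h₁ : 1 + t + t ^ 2 ≠ 0) (h₂ : cofT t a ≠ 0)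
    (hz : zCurve z t = 0) (ha : aCurve t a = 0) :
    1 - z / critZ = (critA - a) ^ 2 * kappa t a := by
  have h3 := one_sub_div_critZ hz
  rw [aCurve_eq] at ha
  rw [kappa, ← mul_div_assoc, eq_div_iff (mul_ne_zero h₂ (pow_ne_zero 2 h₁))]
  linear_combination cofT t a * h3 + cofZ t * ha

theorem one_add_crit : 1 + (critT : ℂ) + (critT : ℂ) ^ 2 = 8 * critT := by
  linear_combination critT_sq_cast

theorem critT_ne_zero : (critT : ℂ) ≠ 0 := by exact_mod_cast critT_pos.ne'

theorem one_add_crit_ne_zero : 1 + (critT : ℂ) + (critT : ℂ) ^ 2 ≠ 0 := by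
  rw [one_add_crit]
  exact mul_ne_zero (by norm_num) critT_ne_zero

theorem kappa_crit : kappa critT critA = (((25 + 3 * √5) / 10 : ℝ) : ℂ) := by
  have h0 := cofT_crit_ne_zero
  rw [kappa, div_eq_iff (mul_ne_zero h0 (pow_ne_zero 2 one_add_crit_ne_zero)), cofT_crit,
    one_add_crit]
  obtain ⟨h1, h2, h3⟩ := crit_cast
  rw [cofA, cofZ, h1, h2]
  push_cast
  generalize ((√5 : ℝ) : ℂ) = s at h3 ⊢
  grind

theorem critT_div : (critT : ℂ) / (1 - critA) = (√5 : ℝ) - 2 := by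
  obtain ⟨h1, h2, h3⟩ := crit_cast
  have h4 : (1 : ℂ) - critA ≠ 0 := one_sub_ne_zero_of_norm_le (by
    have := critA_nonneg
    simp [abs_of_nonneg this])
  rw [div_eq_iff h4, h1, h2]
  linear_combination (-1 / 2 : ℂ) * h3

theorem denom_crit : (1 + (critT : ℂ) + (critT : ℂ) ^ 2) * (1 - critT - 3 * (critT : ℂ) ^ 2) =
    1800 * (√5 : ℝ) - 4024 := by
  obtain ⟨h1, h2, h3⟩ := crit_cast
  rw [h1]
  generalize ((√5 : ℝ) : ℂ) = s at h3 ⊢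
  grind

theorem denom_crit_ne_zero :
    (1 + (critT : ℂ) + (critT : ℂ) ^ 2) * (1 - critT - 3 * (critT : ℂ) ^ 2) ≠ 0 := by
  refine mul_ne_zero one_add_crit_ne_zero (denom_ne_zero ?_)
  simp [abs_of_pos critT_pos]

theorem ratE_crit : ratE critT critA = (211 + 93 * (√5 : ℝ)) / 928 := by
  rw [ratE, div_eq_iff denom_crit_ne_zero, denom_crit, critT_div]
  obtain ⟨h1, h2, h3⟩ := crit_cast
  rw [h1, h2]
  generalize ((√5 : ℝ) : ℂ) = s at h3 ⊢
  grind

/-- The derivative of the generating function along the curve at the critical point, where `t` is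
stationary as a function of `α`. -/
theorem hasDerivAt_ratE {φ : ℂ → ℂ} (hφ : HasDerivAt φ 0 critA) (h₀ : φ critA = critT) :
    HasDerivAt (fun a => ratE (φ a) a) ((265 + 119 * (√5 : ℝ)) / 464) critA := by
  have h4 : (1 : ℂ) - critA ≠ 0 := one_sub_ne_zero_of_norm_le (by
    have := critA_nonneg
    simp [abs_of_nonneg this])
  have hid := hasDerivAt_id (critA : ℂ)
  have h1 : HasDerivAt (fun a => φ a / (1 - a)) (critT / (1 - critA) / (1 - critA)) (critA : ℂ) := by
    convert! hφ.div (hid.const_sub 1) h4 using 1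
    simp only [id, h₀]
    field_simp
    ring
  have hnum : HasDerivAt (fun a : ℂ => φ a + a ^ 2 + (φ a / (1 - a)) ^ 2 +
      2 * φ a * (φ a + a * (φ a / (1 - a))))
      (2 * (critA : ℂ) + 2 * (critT / (1 - critA)) * (critT / (1 - critA) / (1 - critA)) +
        2 * critT * (critT / (1 - critA) + critA * (critT / (1 - critA) / (1 - critA))))
      (critA : ℂ) := by
    convert! ((hφ.add (hid.pow 2)).add (h1.pow 2)).add
      ((hφ.const_mul 2).mul (hφ.add (hid.mul h1))) using 1
    simp [h₀]
  have hden : HasDerivAt (fun a => (1 + φ a + φ a ^ 2) * (1 - φ a - 3 * φ a ^ 2)) 0 (critA : ℂ) := by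
    convert! ((hφ.const_add 1).add (hφ.pow 2)).mul
      ((hφ.const_sub 1).sub ((hφ.pow 2).const_mul 3)) using 1
    simp
  have hne : (fun a => (1 + φ a + φ a ^ 2) * (1 - φ a - 3 * φ a ^ 2)) (critA : ℂ) ≠ 0 := by
    simp only [h₀]
    exact denom_crit_ne_zero
  convert! hnum.div hden hne using 1
  have hσ : (critT : ℂ) / (1 - critA) / (1 - critA) = (3 - (√5 : ℝ)) / 2 := by
    obtain ⟨-, h2, h3⟩ := crit_cast
    rw [critT_div, div_eq_iff h4, h2]
    linear_combination (1 / 4 : ℂ) * h3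
  simp only [h₀, mul_zero, sub_zero]
  rw [eq_div_iff (pow_ne_zero 2 denom_crit_ne_zero), hσ, critT_div, denom_crit]
  obtain ⟨h1, h2, h3⟩ := crit_cast
  rw [h1, h2]
  generalize ((√5 : ℝ) : ℂ) = s at h3 ⊢
  grind

end OrderedTree

namespace OrderedTree

theorem hasDerivAt_aCurve_left (t a : ℂ) :
    HasDerivAt (fun t => aCurve t a) (-(1 - a) ^ 2 - 2 * t * (2 - a)) t := by
  have h1 : HasDerivAt (fun t : ℂ => a - t - a ^ 2) (-1) t := by
    simpa using ((hasDerivAt_id t).const_sub a).sub_const (a ^ 2)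
  convert! ((h1.mul_const ((1 - a) ^ 2)).sub ((hasDerivAt_pow 2 t).mul_const (1 - a))).sub
    (hasDerivAt_pow 2 t) using 1
  simp
  ring

/-- Near the critical point `t` is an analytic function of `α` on the curve, with a critical point
at `α₀`. -/
theorem exists_t_of_a : ∃ φ : ℂ → ℂ, AnalyticAt ℂ φ critA ∧ φ critA = critT ∧
    HasDerivAt φ 0 critA ∧ ∀ᶠ p in 𝓝 ((critA : ℂ), (critT : ℂ)), aCurve p.2 p.1 = 0 → p.2 = φ p.1 := by
  have hcrit : aCurve critT critA = 0 := by
    rw [aCurve_eq]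
    ring
  obtain ⟨φ, hφ, hφ₀, hφe, hφu⟩ := exists_analyticAt_implicit (Φ := fun a t => aCurve t a)
    (x₀ := critA) (y₀ := critT) (analyticAt_aCurve analyticAt_snd analyticAt_fst) hcrit (by
      rw [(hasDerivAt_aCurve_left _ _).deriv]
      intro h
      refine cofT_crit_ne_zero ?_
      rw [cofT]
      linear_combination -h)
  refine ⟨φ, hφ, hφ₀, ?_, hφu⟩
  have hcofT : AnalyticAt ℂ (fun a => cofT (φ a) a) critA := by
    unfold cofT
    fun_prop
  have hne : cofT (φ critA) critA ≠ 0 := by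
    rw [hφ₀]
    exact cofT_crit_ne_zero
  have hm : AnalyticAt ℂ (fun a => cofA a / cofT (φ a) a) critA := by
    refine AnalyticAt.div ?_ hcofT hne
    unfold cofA
    fun_prop
  have h1 : HasDerivAt (fun a : ℂ => a - critA) 1 critA := (hasDerivAt_id _).sub_const _
  have h2 : HasDerivAt (fun a => critT - (a - critA) ^ 2 * (cofA a / cofT (φ a) a)) 0 (critA : ℂ) := by
    convert! ((h1.pow 2).mul hm.differentiableAt.hasDerivAt).const_sub (critT : ℂ) using 1
    simp
  refine h2.congr_of_eventuallyEq ?_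
  filter_upwards [hφe, hcofT.continuousAt.eventually_ne hne] with a ha hne
  rw [aCurve_eq] at ha
  rw [← mul_div_assoc, eq_sub_iff_add_eq, ← eq_sub_iff_add_eq', div_eq_iff hne]
  linear_combination -ha

/-- If `(d * k) ^ 2 = y` with `Re d ≥ 0` and `k` close to the positive real axis, then `d * k` is
the principal square root of a number `y` of positive real part. -/
theorem mul_eq_cpow_half {d k y : ℂ} (hd : 0 ≤ d.re) (hk : |k.im| < k.re) (hy : 0 < y.re)
    (h : (d * k) ^ 2 = y) : d * k = y ^ (1 / 2 : ℂ) := by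
  set s := y ^ (1 / 2 : ℂ) with hs
  have hsq : s ^ 2 = y := Complex.cpow_half_sq y
  have hre : 0 ≤ s.re := by
    rw [hs, one_div, Complex.cpow_inv_two_re]
    exact Real.sqrt_nonneg _
  have hs2 : |s.im| < s.re := by
    have h1 : y.re = s.re ^ 2 - s.im ^ 2 := by
      rw [← hsq, sq, Complex.mul_re]
      ring
    refine abs_lt_of_sq_lt_sq ?_ hre
    linarith
  rcases sq_eq_sq_iff_eq_or_eq_neg.1 (h.trans hsq.symm) with h1 | h1
  · exact h1
  · exfalso
    have h2 : d.re * (k.re ^ 2 + k.im ^ 2) = -(s.re * k.re + s.im * k.im) := by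
      have e1 := congrArg Complex.re h1
      have e2 := congrArg Complex.im h1
      rw [Complex.mul_re, Complex.neg_re] at e1
      rw [Complex.mul_im, Complex.neg_im] at e2
      linear_combination k.re * e1 + k.im * e2
    have h3 : |s.im * k.im| < s.re * k.re := by
      rw [abs_mul]
      exact mul_lt_mul'' hs2 hk (abs_nonneg _) (abs_nonneg _)
    have h4 := neg_abs_le (s.im * k.im)
    have h5 : 0 ≤ d.re * (k.re ^ 2 + k.im ^ 2) := by positivity
    linarith

/-- On the curve, `1 - z / z₀` is the square of an analytic function `S` of `α` with a simple zero at
`α₀`. Its inverse expresses `α`, and hence the generating function, as an analytic function of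
`√(1 - z / z₀)`. -/
theorem expansion_coeffZR : ∃ h : ℂ → ℂ, AnalyticAt ℂ h 0 ∧
    h 0 = (211 + 93 * (√5 : ℝ)) / 928 ∧
    deriv h 0 = -(((265 + 119 * √5) / 464 / √((25 + 3 * √5) / 10) : ℝ) : ℂ) ∧
    ∀ᶠ z in 𝓝 (critZ : ℂ), ‖z‖ < critZ →
      HasSum (fun n => coeffZR n * z ^ n) (h ((1 - z / (critZ : ℂ)) ^ (1 / 2 : ℂ))) := by
  obtain ⟨φ, hφ, hφ₀, hφd, hφu⟩ := exists_t_of_a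
  have hpos : (0 : ℝ) < (25 + 3 * √5) / 10 := by positivity
  have hr : 0 < √((25 + 3 * √5) / 10) := Real.sqrt_pos.2 hpos
  -- the coordinate `S` on the curve, a root of `1 - z / z₀`
  set k : ℂ → ℂ := fun a => kappa (φ a) a ^ (1 / 2 : ℂ) with hk
  have hk₀ : k critA = (√((25 + 3 * √5) / 10) : ℝ) := by
    simp only [hk]
    rw [hφ₀, kappa_crit]
    exact Complex.eq_cpow_half (by simpa using hr)
      (by exact_mod_cast congrArg Complex.ofReal (Real.sq_sqrt hpos.le))
  have hkan : AnalyticAt ℂ k critA := by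
    have h1 : AnalyticAt ℂ (fun a => kappa (φ a) a) critA := by
      unfold kappa
      refine AnalyticAt.div ?_ ?_ ?_
      · unfold cofA cofZ
        fun_prop
      · unfold cofT
        fun_prop
      · rw [hφ₀]
        exact mul_ne_zero cofT_crit_ne_zero (pow_ne_zero 2 one_add_crit_ne_zero)
    refine h1.cpow analyticAt_const ?_
    rw [hφ₀, kappa_crit]
    exact Complex.ofReal_mem_slitPlane.2 hpos
  set S : ℂ → ℂ := fun a => (critA - a) * k a with hS
  have hlin : HasDerivAt (fun a : ℂ => (critA : ℂ) - a) (-1) critA := (hasDerivAt_id _).const_sub _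
  have hSd : HasDerivAt S (-(√((25 + 3 * √5) / 10) : ℝ)) critA := by
    convert! hlin.mul hkan.differentiableAt.hasDerivAt using 1
    simp [hk₀]
  have hS₀ : S critA = 0 := by simp [hS]
  have hne : -((√((25 + 3 * √5) / 10) : ℝ) : ℂ) ≠ 0 := by
    rw [neg_ne_zero]
    exact_mod_cast hr.ne'
  have hSan : AnalyticAt ℂ S critA := (analyticAt_const.sub analyticAt_id).mul hkan
  obtain ⟨H, hH, hH₀, hHe, hHu⟩ := exists_analyticAt_implicit (Φ := fun s a => S a - s)
    (x₀ := 0) (y₀ := critA)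
    ((hSan.fun_comp_of_eq (g := S) analyticAt_snd rfl).sub analyticAt_fst) (by simp [hS₀]) (by
      rw [(hSd.sub_const 0).deriv]
      exact hne)
  have hHd : HasDerivAt H (-(1 / (√((25 + 3 * √5) / 10) : ℝ) : ℂ)) 0 := by
    have h1 := hH.differentiableAt.hasDerivAt
    have h2 : HasDerivAt (fun s => S (H s)) (-(√((25 + 3 * √5) / 10) : ℝ) * deriv H 0) 0 := by
      rw [← hH₀] at hSd
      exact hSd.comp 0 h1
    have h3 : HasDerivAt (fun s => S (H s)) 1 0 :=
      (hasDerivAt_id 0).congr_of_eventuallyEq (hHe.mono fun s hs => sub_eq_zero.1 hs)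
    have h4 := h2.unique h3
    have h5 : deriv H 0 = -(1 / (√((25 + 3 * √5) / 10) : ℝ) : ℂ) := by
      have h6 : ((√((25 + 3 * √5) / 10) : ℝ) : ℂ) ≠ 0 := neg_ne_zero.1 hne
      field_simp
      linear_combination -h4
    rwa [h5] at h1
  have hφH : AnalyticAt ℂ (fun s => φ (H s)) 0 := hφ.fun_comp_of_eq hH hH₀
  refine ⟨fun s => ratE (φ (H s)) (H s), analyticAt_ratE hφH hH ?_ ?_ ?_, ?_, ?_, ?_⟩
  · rw [hH₀, hφ₀]
    exact one_add_crit_ne_zero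
  · rw [hH₀, hφ₀]
    exact denom_ne_zero (by simp [abs_of_pos critT_pos])
  · rw [hH₀]
    exact one_sub_ne_zero_of_norm_le (by simp [abs_of_nonneg critA_nonneg])
  · simp only [hH₀, hφ₀]
    exact ratE_crit
  · have h1 := hasDerivAt_ratE hφd hφ₀
    rw [← hH₀] at h1
    have h2 := h1.comp 0 hHd
    have h3 : deriv (fun s => ratE (φ (H s)) (H s)) 0 = _ := h2.deriv
    rw [h3]
    push_cast
    ring
  · have hmem : (critZ : ℂ) ∈ Metric.closedBall (0 : ℂ) critZ := by simp [abs_of_pos critZ_pos]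
    have tA : Tendsto paramA (𝓝[Metric.closedBall 0 critZ] (critZ : ℂ)) (𝓝 critA) :=
      paramA_critZ ▸ continuousOn_paramA _ hmem
    have tT : Tendsto paramT (𝓝[Metric.closedBall 0 critZ] (critZ : ℂ)) (𝓝 critT) :=
      paramT_critZ ▸ continuousOn_paramT _ hmem
    have tS := (tendsto_sqrt_one_sub_div critZ_pos).mono_left
      (nhdsWithin_le_nhds (s := Metric.closedBall 0 critZ))
    have hcofT : ∀ᶠ p in 𝓝 ((critA : ℂ), (critT : ℂ)), cofT p.2 p.1 ≠ 0 := by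
      have : ContinuousAt (fun p : ℂ × ℂ => cofT p.2 p.1) ((critA : ℂ), (critT : ℂ)) := by
        unfold cofT
        fun_prop
      exact this.eventually_ne cofT_crit_ne_zero
    have hkre : ∀ᶠ a in 𝓝 (critA : ℂ), |(k a).im| < (k a).re := by
      have h1 : ContinuousAt (fun a => |(k a).im|) (critA : ℂ) :=
        (Complex.continuous_im.continuousAt.comp hkan.continuousAt).abs
      have h2 : ContinuousAt (fun a => (k a).re) (critA : ℂ) :=
        Complex.continuous_re.continuousAt.comp hkan.continuousAt
      refine h1.eventually_lt h2 ?_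
      rw [hk₀]
      simpa using hr
    have hkre' : ∀ᶠ p in 𝓝 ((critA : ℂ), (critT : ℂ)), |(k p.1).im| < (k p.1).re :=
      (continuous_fst.tendsto ((critA : ℂ), (critT : ℂ))).eventually hkre
    filter_upwards [eventually_param tA tT hφu, eventually_param tA tT hcofT,
      eventually_param tA tT hkre', eventually_param tS tA hHu] with z h1 h2 h3 h4 hzR
    have hzR' := hzR.le
    obtain ⟨e1, e2, e3, e4⟩ := param_equations hzR'
    have htφ : paramT z = φ (paramA z) := h1 hzR' e3
    have hzne : z ≠ critZ := by
      rintro rfl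
      simp [abs_of_pos critZ_pos] at hzR
    have hsq : (S (paramA z)) ^ 2 = 1 - z / critZ := by
      rw [one_sub_div_critZ_eq e1 (h2 hzR') e2 e3]
      simp only [hS, hk]
      rw [mul_pow, Complex.cpow_half_sq, ← htφ]
    have hd : 0 ≤ ((critA : ℂ) - paramA z).re := by
      have h5 := (Complex.re_le_norm (paramA z)).trans (norm_paramA_le hzR')
      rw [Complex.sub_re, Complex.ofReal_re]
      linarith
    have hSs := mul_eq_cpow_half hd (h3 hzR') (one_sub_div_re_pos critZ_pos hzR' hzne) hsq
    have haH := h4 hzR' (sub_eq_zero.2 hSs)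
    rw [← haH, ← htφ, ← e4]
    exact hasSum_coeffZR hzR'

/-! ### Asymptotics of the expectation -/

theorem singular_coeff_eq : (265 + 119 * √5) / 464 / √((25 + 3 * √5) / 10) =
    1 / 232 * √(5 * (128985 + 57683 * √5) / 58) := by
  have hpos : (0 : ℝ) < (25 + 3 * √5) / 10 := by positivity
  rw [div_eq_iff (Real.sqrt_pos.2 hpos).ne', mul_assoc, ← Real.sqrt_mul (by positivity)]
  have h : 5 * (128985 + 57683 * √5) / 58 * ((25 + 3 * √5) / 10) = ((265 + 119 * √5) / 2) ^ 2 := by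
    have := sqrt_five_sq
    linear_combination (3 * 57683 / 116 - 119 ^ 2 / 4 : ℝ) * this
  rw [h, Real.sqrt_sq (by positivity)]
  ring

theorem ofReal_expectation (n : ℕ) :
    ((expectation (fun T => (hosoyaIndex T.graph : ℝ) * (subtreeIndex T.graph : ℝ)) (n + 2) : ℝ) : ℂ) =
      coeffZR (n + 2) / catalan (n + 1) := by
  rw [expectation, coeffZR, card_treesOfOrder_succ]
  push_cast [hosoyaMulSubtree]
  rfl

theorem four_mul_critZ_inv : (4 * critZ)⁻¹ = 8 * (7 - 3 * √5) := by
  refine inv_eq_of_mul_eq_one_right ?_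
  unfold critZ
  linear_combination (-9 / 4 : ℝ) * sqrt_five_sq

end OrderedTree

open OrderedTree in
theorem mainTheorem2 :
    HasDominantSqrtSingularity OrderedTree.coeffZR
      ((7 + 3 * Real.sqrt 5) / 128)
      ((211 + 93 * Real.sqrt 5) / 928)
      (1 / 232 * Real.sqrt (5 * (128985 + 57683 * Real.sqrt 5) / 58)) ∧
    Asymptotics.IsEquivalent atTop
      (OrderedTree.expectation fun T =>
        (hosoyaIndex T.graph : ℝ) * (subtreeIndex T.graph : ℝ))
      (fun n : ℕ => 1 / 116 * Real.sqrt (5 * (128985 + 57683 * Real.sqrt 5) / 58) *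
        (8 * (7 - 3 * Real.sqrt 5)) ^ n) := by
  rw [← singular_coeff_eq]
  set c : ℝ := (265 + 119 * √5) / 464 / √((25 + 3 * √5) / 10) with hc
  have hcpos : 0 < c := by positivity
  have hmain : 1 / 116 * √(5 * (128985 + 57683 * √5) / 58) = 2 * c := by
    rw [hc, singular_coeff_eq]
    ring
  rw [hmain]
  change HasDominantSqrtSingularity coeffZR critZ _ c ∧ _
  have hz := critZ_pos
  have hreg := fun (ζ : ℂ) (h₁ : ‖ζ‖ = critZ) (h₂ : ζ ≠ (critZ : ℂ)) => regular_coeffZR h₁ h₂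
  obtain ⟨h, hh, hh₀, hhd, hexp⟩ := expansion_coeffZR
  have hlim := tendsto_coeff_div_catalan (c₁ := (c : ℂ)) hz
    (fun z hz => (hasSum_coeffZR hz.le).summable) hreg ⟨h, hh, hhd, hexp⟩
  refine ⟨⟨hz, hcpos.ne', ?_, hreg, h, hh, ?_, hhd, hexp⟩, ?_⟩
  · exact radius_eq_of_tendsto_coeff_div_catalan hz
      (mul_ne_zero two_ne_zero (by exact_mod_cast hcpos.ne')) hlim
  · rw [hh₀]
    push_cast
    rfl
  · have hpow : ∀ n : ℕ, (0 : ℝ) < (8 * (7 - 3 * √5)) ^ n := fun n => by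
      rw [← four_mul_critZ_inv]
      positivity
    rw [Asymptotics.isEquivalent_iff_tendsto_one
      (Eventually.of_forall fun n => (mul_pos (by positivity) (hpow n)).ne'),
      ← tendsto_add_atTop_iff_nat 2]
    have hre := (Complex.continuous_re.tendsto _).comp hlim
    have hre' := hre.div_const (2 * c)
    have e : ((2 : ℂ) * (c : ℂ)).re / (2 * c) = 1 := by
      simp [hcpos.ne']
    rw [e] at hre'
    refine hre'.congr fun n => ?_
    simp only [Function.comp_apply, Pi.div_apply]
    have e1 : coeffZR (n + 2) * (4 * (critZ : ℂ)) ^ (n + 2) / catalan (n + 1) =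
        ((expectation (fun T => (hosoyaIndex T.graph : ℝ) * (subtreeIndex T.graph : ℝ)) (n + 2) *
          (4 * critZ) ^ (n + 2) : ℝ) : ℂ) := by
      rw [Complex.ofReal_mul, ofReal_expectation]
      push_cast
      ring
    rw [e1, Complex.ofReal_re, ← four_mul_critZ_inv, inv_pow]
    field_simp
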